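/- For a metric space $X$ let $\dim_t X$ be its small inductive topological dimension ($\dim_t\emptyset=-1$) and $\dim_H X$ its Hausdorff dimension, with the convention $\dim_H\emptyset=-1$. The topological Hausdorff dimension is defined by $\dim_{tH}\emptyset=-1$ and, for non-empty $X$, \[ \dim_{tH}X=\inf\{d:\ X\text{ has a basis }\mathcal U\text{ of open sets such that }\dim_H\partial U\le d-1\text{ for every }U\in\mathcal U\}, \] where $\infty-1=\infty$, so that $d=\infty$ always belongs to this set. **Theorem.** For extended real numbers $d,s,t\in[-\infty,\infty]$ the following are equivalent. (i) There is a compact metric space $K$ with $\dim_t K=d$, $\dim_{tH}K=s$ and $\dim_H K=t$. (ii) There is a separable metric space $X$ with $\dim_t X=d$, $\dim_{tH}X=s$ and $\dim_H X=t$. (iii) There is a metric space $X$ with $\dim_t X=d$, $\dim_{tH}X=s$ and $\dim_H X=t$. (iv) Either $d=s=t=-1$; or $d=s=0$ and $t\in[0,\infty]$; or $d\in\{1,2,3,\dots\}\cup\{\infty\}$, $s,t\in[1,\infty]$ and $d\le s\le t$. Moreover, $\dim_{tH}$ is not a function of $\dim_t$ and $\dim_H$, even for compact metric spaces: there is no function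 $f$ of two extended real variables, with extended real values, such that $\dim_{tH}K=f(\dim_t K,\dim_H K)$ for every compact metric space $K$. -/

import Mathlib

open Set Topology TopologicalSpace
open scoped ENNReal

universe u

/-- The topological (small inductive) dimension of a space, as an extended real number.
It is Mathlib's `smallInductiveDimension`, whose value `⊥` (attained exactly by the empty space)
is read as `-1`. -/
noncomputable def topDim (X : Type*) [TopologicalSpace X] : EReal :=
  ((smallInductiveDimension X).map (fun n : ℕ∞ => ((n : ℝ≥0∞) : EReal))).unbotD (-1)

open Classical in
/-- The Hausdorff dimension of a subset of a metric space (with the restricted metric), as an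
extended real number, with the convention `dim_H ∅ = -1`. -/
noncomputable def hausDimSet {X : Type*} [MetricSpace X] (A : Set X) : EReal :=
  if A = ∅ then -1 else ((dimH A : ℝ≥0∞) : EReal)

/-- The Hausdorff dimension of a metric space, with `dim_H ∅ = -1`. -/
noncomputable def hausDim (X : Type*) [MetricSpace X] : EReal :=
  hausDimSet (Set.univ : Set X)

open Classical in
/-- The topological Hausdorff dimension of a metric space: `-1` for the empty space, otherwise the
infimum of all `d` such that `X` has a basis all of whose members have a boundary of Hausdorff
dimension at most `d - 1` (here `∞ - 1 = ∞`, so `d = ∞` always qualifies). -/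
noncomputable def topHausDim (X : Type*) [MetricSpace X] : EReal :=
  if IsEmpty X then -1
  else sInf {d : EReal | ∃ B : Set (Set X), IsTopologicalBasis B ∧
    ∀ U ∈ B, hausDimSet (frontier U) ≤ d - 1}

/-!
Every metric space satisfies `dim_t ≤ dim_tH ≤ dim_H`. The second inequality comes from a weak
form of Eilenberg's inequality (`ae_dimH_levelSet`): almost every level set of a Lipschitz
function is empty or loses at least one Hausdorff dimension, so almost all balls around a point
have a boundary of Hausdorff dimension at most `dim_H X - 1`. By induction a space with
`dim_H X < n` has `dim_t X < n` (`hasSmallInductiveDimensionLT_of_hausDim_lt`), and this, applied to the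
boundaries of the members of a basis, gives the first inequality. No separability is used. If
`dim_t X = 0`, then a basis of clopen sets shows `dim_tH X = 0`.

Conversely, for finite `d ≥ 1` the disjoint union of the cube `[0, 1]ᵈ`, a product `C × [0, 1]`
with a Cantor space `C` of Hausdorff dimension `s - 1` (a point if `s = 1`) and a Cantor space of
Hausdorff dimension `t` has the dimensions `d`, `s`, `t`. The Cantor spaces are spaces of binary
sequences with an ultrametric; their dimension is bounded below by reading sequences as binary
digits, a Hölder map onto `[0, 1]`. The bound `dim_tH (C × [0, 1]) ≥ s` holds because the boundary
of a small neighbourhood of a point projects onto a non-empty open subset of `C`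
(`le_topHausDim_prod_unitInterval`). For `d = ∞` the Hilbert cube suffices.

What remains is `dim_t [0, 1]ⁿ ≥ n` (`not_hasSmallInductiveDimensionLT_cube`). A separable metric
space with `dim_t < n` is a union of `n` zero-dimensional subspaces, by the countable sum theorem
in dimension zero. Each of them can be avoided by a partition between a pair of disjoint closed
sets, so the pairs of opposite faces of the cube would have partitions without a common point.
This is impossible (`exists_notMem_of_separates_faces`). The combinatorial core is
`exists_cube_forall_exists_and_exists_not`, a discrete version of the theorem that the degree of a
map of the cube is determined by its behaviour on the faces: for the Kuhn triangulation of a grid,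
the sum of the signed volumes `det (1; G₁; …; Gₙ)` of the images of the simplices is determined by
the values on the faces, by a discrete integration by parts, and it is `n!` for the coordinate
steps.
-/

/-! ### Signed volumes in the Kuhn triangulation of a grid -/

/-- The vertex with index `k` of the Kuhn simplex with base point `v` and order `τ`: starting at
`v`, the coordinates are raised by one in turn, the coordinate `j` at time `τ j`. -/
def kuhnVertex {n : ℕ} (v : Fin n → ℕ) (τ : Equiv.Perm (Fin n)) (k : Fin (n + 1)) : Fin n → ℕ :=
  fun j => v j + if (τ j : ℕ) < k then 1 else 0

/-- The matrix with a first row of ones and further rows `G i ∘ p`. Its determinant is the volume,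
up to a constant, of the image under `G` of the simplex with vertices `p k`. -/
def volMatrix {n : ℕ} {α : Type*} (G : Fin n → α → ℤ) (p : Fin (n + 1) → α) :
    Matrix (Fin (n + 1)) (Fin (n + 1)) ℤ :=
  Matrix.of fun r k => (Fin.cons (fun _ => 1) G : Fin (n + 1) → α → ℤ) r (p k)

/-- The total signed volume of the images under `G` of the Kuhn simplices in `[0, m]ⁿ`. -/
def totalVol {n : ℕ} (m : ℕ) (G : Fin n → (Fin n → ℕ) → ℤ) : ℤ :=
  ∑ v ∈ Fintype.piFinset (fun _ : Fin n => Finset.range m), ∑ τ : Equiv.Perm (Fin n),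
    (Equiv.Perm.sign τ : ℤ) * (volMatrix G (kuhnVertex v τ)).det

/-- The facets that arise by dropping an intermediate vertex cancel in pairs. -/
lemma sum_middle_facets_eq_zero {N : ℕ} (v : Fin (N + 1) → ℕ)
    (Ψ : (Fin (N + 1) → Fin (N + 1) → ℕ) → ℤ) (i : Fin N) :
    ∑ τ : Equiv.Perm (Fin (N + 1)), (Equiv.Perm.sign τ : ℤ) *
      Ψ (fun l => kuhnVertex v τ (i.succ.castSucc.succAbove l)) = 0 := by
  -- Exchanging the two steps around the dropped vertex changes the sign of `τ`, not the facet.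
  set s : Equiv.Perm (Fin (N + 1)) := Equiv.swap i.castSucc i.succ with hs
  have hne : i.castSucc ≠ i.succ := (Fin.castSucc_lt_succ).ne
  have key : ∀ τ : Equiv.Perm (Fin (N + 1)),
      (fun l => kuhnVertex v (s * τ) (i.succ.castSucc.succAbove l)) =
      fun l => kuhnVertex v τ (i.succ.castSucc.succAbove l) := by
    intro τ
    funext l j
    have hl : ((i.succ.castSucc.succAbove l : Fin (N + 2)) : ℕ) ≠ i + 1 := by
      have := Fin.succAbove_ne i.succ.castSucc l
      intro h
      exact this (Fin.ext (by simpa using h))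
    have hiff : ((s (τ j) : ℕ) < (i.succ.castSucc.succAbove l : Fin (N + 2))) ↔
        ((τ j : ℕ) < (i.succ.castSucc.succAbove l : Fin (N + 2))) := by
      by_cases h1 : τ j = i.castSucc
      · rw [h1, hs, Equiv.swap_apply_left]
        simp only [Fin.val_succ, Fin.val_castSucc]
        omega
      by_cases h2 : τ j = i.succ
      · rw [h2, hs, Equiv.swap_apply_right]
        simp only [Fin.val_succ, Fin.val_castSucc]
        omega
      rw [hs, Equiv.swap_apply_of_ne_of_ne h1 h2]
    change v j + (if (s (τ j) : ℕ) < _ then 1 else 0) = v j + _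
    simp only [hiff]
  have h := Equiv.sum_comp (Equiv.mulLeft s)
    (fun τ : Equiv.Perm (Fin (N + 1)) => (Equiv.Perm.sign τ : ℤ) *
      Ψ (fun l => kuhnVertex v τ (i.succ.castSucc.succAbove l)))
  simp only [Equiv.coe_mulLeft, key, map_mul] at h
  simp only [hs, Equiv.Perm.sign_swap hne, neg_mul, one_mul, Units.val_neg,
    Finset.sum_neg_distrib] at h
  omega

/-- A telescoping sum along the coordinate `j`. -/
lemma sum_shift_eq {n m : ℕ} (j : Fin n) (f : (Fin n → ℕ) → ℤ)
    (h0 : ∀ v, v j = 0 → f v = 0) (hm : ∀ v, v j = m → f v = 0) :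
    ∑ v ∈ Fintype.piFinset (fun _ : Fin n => Finset.range m), f (v + Pi.single j 1) =
      ∑ v ∈ Fintype.piFinset (fun _ : Fin n => Finset.range m), f v := by
  refine Finset.sum_bij_ne_zero (fun v _ _ => v + Pi.single j 1) ?_ ?_ ?_ ?_
  · intro v hv hf
    rw [Fintype.mem_piFinset] at hv ⊢
    intro a
    have := hv a
    rw [Finset.mem_range] at this ⊢
    by_cases ha : a = j
    · subst ha
      have h2 : (v + Pi.single a 1 : Fin n → ℕ) a ≠ m := fun h => hf (hm _ h)
      simp at h2 ⊢; omega
    · simpa [ha] using this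
  · intro a _ _ b _ _ h
    exact add_right_cancel h
  · intro b hb hf
    rw [Fintype.mem_piFinset] at hb
    have hb0 : b j ≠ 0 := fun h => hf (h0 _ h)
    have e : (b - Pi.single j 1) + Pi.single j 1 = b := by
      funext a
      by_cases ha : a = j
      · subst ha; simp; omega
      · simp [ha]
    refine ⟨b - Pi.single j 1, ?_, by rwa [e], e⟩
    rw [Fintype.mem_piFinset]
    intro a
    have := hb a
    rw [Finset.mem_range] at this ⊢
    simp only [Pi.sub_apply]; omega
  · intros; rfl

lemma kuhnVertex_rotate {N : ℕ} (v : Fin (N + 1) → ℕ) (τ : Equiv.Perm (Fin (N + 1)))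
    (l : Fin (N + 1)) :
    kuhnVertex v (finRotate (N + 1) * τ) l.succ =
      kuhnVertex (v + Pi.single (τ.symm (Fin.last N)) 1) τ l.castSucc := by
  funext j
  simp only [kuhnVertex, Equiv.Perm.coe_mul, Function.comp, Fin.val_succ, Fin.val_castSucc,
    Pi.add_apply, coe_finRotate]
  have hl := l.isLt
  by_cases h : τ j = Fin.last N
  · have : j = τ.symm (Fin.last N) := by rw [← h]; simp
    subst this
    simp; omega
  · have : j ≠ τ.symm (Fin.last N) := by rintro rfl; simp at h
    rw [if_neg h, Pi.single_eq_of_ne this]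
    simp

/-- The facets without a first vertex and the facets without a last vertex cancel up to facets in
the boundary of the grid, where `Ψ` vanishes. -/
lemma sum_end_facets_eq_zero {N m : ℕ} (Ψ : (Fin (N + 1) → Fin (N + 1) → ℕ) → ℤ)
    (h0 : ∀ q j, (∀ l, q l j = 0) → Ψ q = 0) (hm : ∀ q j, (∀ l, q l j = m) → Ψ q = 0) :
    ∑ v ∈ Fintype.piFinset (fun _ : Fin (N + 1) => Finset.range m),
      ∑ τ : Equiv.Perm (Fin (N + 1)),
        (Equiv.Perm.sign τ : ℤ) * Ψ (fun l => kuhnVertex v τ l.succ) =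
    (-1) ^ N * ∑ v ∈ Fintype.piFinset (fun _ : Fin (N + 1) => Finset.range m),
      ∑ τ : Equiv.Perm (Fin (N + 1)),
        (Equiv.Perm.sign τ : ℤ) * Ψ (fun l => kuhnVertex v τ l.castSucc) := by
  -- The facet without its first vertex is the facet without its last vertex of a neighbouring cube.
  have h1 : ∀ v : Fin (N + 1) → ℕ, ∑ τ : Equiv.Perm (Fin (N + 1)),
        (Equiv.Perm.sign τ : ℤ) * Ψ (fun l => kuhnVertex v τ l.succ) =
      ∑ τ : Equiv.Perm (Fin (N + 1)), (-1) ^ N * ((Equiv.Perm.sign τ : ℤ) *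
        Ψ (fun l => kuhnVertex (v + Pi.single (τ.symm (Fin.last N)) 1) τ l.castSucc)) := by
    intro v
    rw [← Equiv.sum_comp (Equiv.mulLeft (finRotate (N + 1)))]
    refine Finset.sum_congr rfl fun τ _ => ?_
    simp only [Equiv.coe_mulLeft, kuhnVertex_rotate, map_mul, sign_finRotate]
    simp [mul_assoc]
  simp only [h1]
  rw [Finset.sum_comm, Finset.sum_comm (s := Fintype.piFinset _), Finset.mul_sum]
  refine Finset.sum_congr rfl fun τ _ => ?_
  rw [Finset.mul_sum, ← Finset.mul_sum, ← Finset.mul_sum, ← Finset.mul_sum, ← Finset.mul_sum,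
    sum_shift_eq (τ.symm (Fin.last N)) (fun v => Ψ (fun l => kuhnVertex v τ l.castSucc))]
  · intro v hv
    refine h0 _ (τ.symm (Fin.last N)) fun l => ?_
    have := l.isLt
    simp [kuhnVertex, hv]; omega
  · intro v hv
    refine hm _ (τ.symm (Fin.last N)) fun l => ?_
    have := l.isLt
    simp [kuhnVertex, hv]; omega

/-- Stokes' theorem for the Kuhn triangulation: interior facets cancel. -/
lemma sum_facets_eq_zero {N m : ℕ} (Ψ : (Fin (N + 1) → Fin (N + 1) → ℕ) → ℤ)
    (h0 : ∀ q j, (∀ l, q l j = 0) → Ψ q = 0) (hm : ∀ q j, (∀ l, q l j = m) → Ψ q = 0) :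
    ∑ v ∈ Fintype.piFinset (fun _ : Fin (N + 1) => Finset.range m),
      ∑ τ : Equiv.Perm (Fin (N + 1)), (Equiv.Perm.sign τ : ℤ) *
        ∑ k : Fin (N + 2), (-1) ^ (k : ℕ) * Ψ (fun l => kuhnVertex v τ (k.succAbove l)) = 0 := by
  have h1 : ∀ v : Fin (N + 1) → ℕ, ∑ τ : Equiv.Perm (Fin (N + 1)), (Equiv.Perm.sign τ : ℤ) *
        ∑ k : Fin (N + 2), (-1) ^ (k : ℕ) * Ψ (fun l => kuhnVertex v τ (k.succAbove l)) =
      (∑ τ : Equiv.Perm (Fin (N + 1)),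
        (Equiv.Perm.sign τ : ℤ) * Ψ (fun l => kuhnVertex v τ l.succ)) +
      (-1) ^ (N + 1) * ∑ τ : Equiv.Perm (Fin (N + 1)),
        (Equiv.Perm.sign τ : ℤ) * Ψ (fun l => kuhnVertex v τ l.castSucc) := by
    intro v
    have h2 : ∀ τ : Equiv.Perm (Fin (N + 1)), (Equiv.Perm.sign τ : ℤ) *
        ∑ k : Fin (N + 2), (-1) ^ (k : ℕ) * Ψ (fun l => kuhnVertex v τ (k.succAbove l)) =
        ∑ k : Fin (N + 2), (-1) ^ (k : ℕ) * ((Equiv.Perm.sign τ : ℤ) *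
          Ψ (fun l => kuhnVertex v τ (k.succAbove l))) := by
      intro τ
      rw [Finset.mul_sum]
      exact Finset.sum_congr rfl fun k _ => by ring
    simp only [h2]
    rw [Finset.sum_comm]
    simp only [← Finset.mul_sum]
    have h3 : ∀ i : Fin N, (-1) ^ ((i.castSucc.succ : Fin (N + 2)) : ℕ) *
        ∑ τ : Equiv.Perm (Fin (N + 1)), (Equiv.Perm.sign τ : ℤ) *
          Ψ (fun l => kuhnVertex v τ (i.castSucc.succ.succAbove l)) = 0 := fun i => by
      rw [Fin.succ_castSucc, sum_middle_facets_eq_zero, mul_zero]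
    rw [Fin.sum_univ_succ, Fin.sum_univ_castSucc, Finset.sum_eq_zero fun i _ => h3 i]
    simp
  simp only [h1]
  rw [Finset.sum_add_distrib, sum_end_facets_eq_zero Ψ h0 hm, ← Finset.mul_sum]
  ring

/-- The volume form `det (1; G)` is exact: it is the alternating sum, over the facets, of the sum
of the values of `G i` times the determinant formed by the other functions. -/
lemma det_volMatrix_eq_facets {N : ℕ} {α : Type*} (G : Fin (N + 1) → α → ℤ) (i : Fin (N + 1))
    (p : Fin (N + 2) → α) :
    (volMatrix G p).det = (-1) ^ (i : ℕ) * ∑ k : Fin (N + 2), (-1) ^ (k : ℕ) *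
      ((∑ l, G i (p (k.succAbove l))) * (Matrix.of fun (r : Fin (N + 1)) l =>
        (Fin.cons (fun _ => 1) G : Fin (N + 2) → α → ℤ) (i.succ.succAbove r)
          (p (k.succAbove l))).det) := by
  set Nk : Fin (N + 2) → ℤ := fun k => (Matrix.of fun (r : Fin (N + 1)) l =>
        (Fin.cons (fun _ => 1) G : Fin (N + 2) → α → ℤ) (i.succ.succAbove r)
          (p (k.succAbove l))).det with hNk
  have h1 : (volMatrix G p).det =
      ∑ k : Fin (N + 2), (-1) ^ ((i.succ : ℕ) + k) * G i (p k) * Nk k := by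
    rw [Matrix.det_succ_row _ i.succ]
    rfl
  -- Replacing the row `i` by a second row of ones gives a singular matrix.
  have h2 : (0 : ℤ) = ∑ k : Fin (N + 2), (-1) ^ ((i.succ : ℕ) + k) * 1 * Nk k := by
    have h0 : ((volMatrix G p).updateRow i.succ (fun _ => 1)).det = 0 := by
      refine Matrix.det_zero_of_row_eq (Fin.succ_ne_zero i) ?_
      rw [Matrix.updateRow_self, Matrix.updateRow_ne (Fin.succ_ne_zero i).symm]
      rfl
    rw [← h0, Matrix.det_succ_row _ i.succ]
    refine Finset.sum_congr rfl fun k _ => ?_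
    rw [Matrix.updateRow_self, Matrix.submatrix_updateRow_succAbove]
    rfl
  have h3 : ∀ k : Fin (N + 2), ∑ l, G i (p (k.succAbove l)) = (∑ l, G i (p l)) - G i (p k) := by
    intro k
    rw [Fin.sum_univ_succAbove (fun l => G i (p l)) k]
    ring
  have h4 : (∑ l, G i (p l)) * ∑ k : Fin (N + 2), (-1) ^ ((i.succ : ℕ) + k) * 1 * Nk k = 0 := by
    rw [← h2, mul_zero]
  rw [h1, ← sub_zero (∑ k, _), ← h4, Finset.mul_sum, Finset.mul_sum, ← Finset.sum_sub_distrib]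
  refine Finset.sum_congr rfl fun k _ => ?_
  rw [h3]
  simp only [Fin.val_succ, pow_add]
  ring

/-- Integration by parts: the total volume vanishes if one of the functions vanishes on its two
faces of the cube. -/
lemma totalVol_eq_zero {n m : ℕ} (G : Fin n → (Fin n → ℕ) → ℤ) (i : Fin n)
    (hi0 : ∀ x, x i = 0 → G i x = 0) (him : ∀ x, x i = m → G i x = 0)
    (h0 : ∀ j ≠ i, ∀ x, x j = 0 → G j x = 0) (hm : ∀ j ≠ i, ∀ x, x j = m → G j x = 1) :
    totalVol m G = 0 := by
  obtain _ | N := n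
  · exact i.elim0
  set Ψ : (Fin (N + 1) → Fin (N + 1) → ℕ) → ℤ := fun q =>
    (∑ l, G i (q l)) * (Matrix.of fun (r : Fin (N + 1)) l =>
        (Fin.cons (fun _ => 1) G : Fin (N + 2) → _ → ℤ) (i.succ.succAbove r) (q l)).det with hΨ
  have hconst : ∀ (q : Fin (N + 1) → Fin (N + 1) → ℕ) (j : Fin (N + 1)) (c : ℤ), j ≠ i →
      (∀ l, G j (q l) = c) → Ψ q = 0 := by
    intro q j c hj hc
    obtain ⟨r, hr⟩ := Fin.exists_succAbove_eq (x := j.succ) (y := i.succ)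
      (fun h => hj (Fin.succ_injective _ h))
    have hr0 : r ≠ 0 := by
      rintro rfl
      rw [Fin.succAbove_ne_zero_zero (Fin.succ_ne_zero i)] at hr
      exact Fin.succ_ne_zero j hr.symm
    have : (Matrix.of fun (r : Fin (N + 1)) l =>
        (Fin.cons (fun _ => 1) G : Fin (N + 2) → _ → ℤ) (i.succ.succAbove r) (q l)).det = 0 := by
      rw [← Matrix.det_updateRow_add_smul_self _ hr0 (-c)]
      refine Matrix.det_eq_zero_of_row_eq_zero r fun l => ?_
      simp [Matrix.updateRow_self, hr, hc, Fin.succAbove_ne_zero_zero (Fin.succ_ne_zero i)]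
    simp only [hΨ, this, mul_zero]
  have key := sum_facets_eq_zero (m := m) Ψ
    (fun q j hq => by
      by_cases hj : j = i
      · subst hj
        simp only [hΨ, hi0 _ (hq _), Finset.sum_const_zero, zero_mul]
      · exact hconst q j 0 hj fun l => h0 j hj _ (hq l))
    (fun q j hq => by
      by_cases hj : j = i
      · subst hj
        simp only [hΨ, him _ (hq _), Finset.sum_const_zero, zero_mul]
      · exact hconst q j 1 hj fun l => hm j hj _ (hq l))
  have h1 : totalVol m G = (-1) ^ (i : ℕ) *
      ∑ v ∈ Fintype.piFinset (fun _ : Fin (N + 1) => Finset.range m),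
      ∑ τ : Equiv.Perm (Fin (N + 1)), (Equiv.Perm.sign τ : ℤ) *
        ∑ k : Fin (N + 2), (-1) ^ (k : ℕ) * Ψ (fun l => kuhnVertex v τ (k.succAbove l)) := by
    rw [totalVol, Finset.mul_sum]
    refine Finset.sum_congr rfl fun v _ => ?_
    rw [Finset.mul_sum]
    refine Finset.sum_congr rfl fun τ _ => ?_
    rw [det_volMatrix_eq_facets G i]
    ring
  rw [h1, key, mul_zero]

lemma volMatrix_update {n : ℕ} {α : Type*} (G : Fin n → α → ℤ) (i : Fin n) (g : α → ℤ)
    (p : Fin (n + 1) → α) :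
    volMatrix (Function.update G i g) p = (volMatrix G p).updateRow i.succ (fun k => g (p k)) := by
  ext r k
  refine Fin.cases ?_ (fun j => ?_) r
  · rw [Matrix.updateRow_ne (Fin.succ_ne_zero i).symm]; rfl
  · by_cases h : j = i
    · subst h; simp [volMatrix]
    · rw [Matrix.updateRow_ne (fun h' => h (Fin.succ_injective _ h'))]
      simp [volMatrix, h]

lemma totalVol_update_sub {n m : ℕ} (G : Fin n → (Fin n → ℕ) → ℤ) (i : Fin n)
    (g : (Fin n → ℕ) → ℤ) :
    totalVol m G = totalVol m (Function.update G i g) +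
      totalVol m (Function.update G i (G i - g)) := by
  simp only [totalVol, ← Finset.sum_add_distrib, ← mul_add, volMatrix_update]
  refine Finset.sum_congr rfl fun v _ => Finset.sum_congr rfl fun τ _ => ?_
  rw [← Matrix.det_updateRow_add]
  congr 2
  ext r k
  by_cases h : r = i.succ
  · subst h; simp [volMatrix]
  · rw [Matrix.updateRow_ne h]

/-- The total volume is determined by the values on the faces: changing one function at a time, the
difference vanishes by integration by parts. -/
lemma totalVol_congr {n m : ℕ} (G H : Fin n → (Fin n → ℕ) → ℤ)
    (hG0 : ∀ i x, x i = 0 → G i x = 0) (hGm : ∀ i x, x i = m → G i x = 1)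
    (hH0 : ∀ i x, x i = 0 → H i x = 0) (hHm : ∀ i x, x i = m → H i x = 1) :
    totalVol m G = totalVol m H := by
  have key : ∀ S : Finset (Fin n), totalVol m (S.piecewise H G) = totalVol m G := by
    intro S
    induction S using Finset.induction_on with
    | empty => simp
    | insert i S hi ih =>
      rw [← ih, totalVol_update_sub (S.piecewise H G) i (H i), Finset.piecewise_insert,
        left_eq_add]
      refine totalVol_eq_zero _ i ?_ ?_ ?_ ?_
      · intro x hx
        simp [hi, hG0 i x hx, hH0 i x hx]
      · intro x hx
        simp [hi, hGm i x hx, hHm i x hx]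
      · intro j hj x hx
        by_cases h : j ∈ S <;> simp [h, hj, hG0 j x hx, hH0 j x hx]
      · intro j hj x hx
        by_cases h : j ∈ S <;> simp [h, hj, hGm j x hx, hHm j x hx]
  rw [← key Finset.univ, Finset.piecewise_univ]

/-- The coordinate steps, whose total volume is computed directly. -/
def stepFun (n : ℕ) (i : Fin n) (x : Fin n → ℕ) : ℤ := if x i = 0 then 0 else 1

lemma totalVol_stepFun {n m : ℕ} (hm : m ≠ 0) : totalVol m (stepFun n) = n.factorial := by
  have hdet : ∀ (v : Fin n → ℕ) (τ : Equiv.Perm (Fin n)),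
      (Equiv.Perm.sign τ : ℤ) * (volMatrix (stepFun n) (kuhnVertex v τ)).det =
        if v = 0 then 1 else 0 := by
    intro v τ
    split_ifs with hv
    · subst hv
      -- Up to a permutation of the rows the matrix is `1` on and above the diagonal.
      have h1 : volMatrix (stepFun n) (kuhnVertex 0 τ) =
          (Matrix.of fun r k : Fin (n + 1) => if r ≤ k then (1 : ℤ) else 0).submatrix
            (Equiv.Perm.decomposeFin.symm (0, τ)) id := by
        ext r k
        refine Fin.cases ?_ (fun j => ?_) r
        · simp [volMatrix]
        · have e : (Equiv.Perm.decomposeFin.symm (0, τ)) j.succ = (τ j).succ := by simp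
          change stepFun n j (kuhnVertex 0 τ k) =
            if (Equiv.Perm.decomposeFin.symm (0, τ)) j.succ ≤ k then (1 : ℤ) else 0
          rw [e]
          simp only [stepFun, kuhnVertex, Fin.le_def, Fin.val_succ, Nat.succ_le_iff,
            Pi.zero_apply, zero_add]
          split_ifs <;> simp_all
      have h2 : (Matrix.of fun r k : Fin (n + 1) => if r ≤ k then (1 : ℤ) else 0).det = 1 := by
        rw [Matrix.det_of_isUpperTriangular]
        · simp
        · intro r k h
          simp at h
          simp [h]
      rw [h1, Matrix.det_permute, h2, Equiv.Perm.decomposeFin.symm_sign]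
      simp [← Units.val_mul]
    · obtain ⟨i, hi⟩ := Function.ne_iff.1 hv
      rw [Matrix.det_zero_of_row_eq (Fin.succ_ne_zero i), mul_zero]
      ext k
      have : kuhnVertex v τ k i ≠ 0 := by
        simp only [kuhnVertex, Pi.zero_apply] at hi ⊢; omega
      simp [volMatrix, stepFun, this]
  simp only [totalVol, hdet]
  simp [Fintype.mem_piFinset, Nat.pos_of_ne_zero hm, Fintype.card_perm]

/-- The discrete intermediate value theorem in dimension `n`: if the truth value of `P i` is
prescribed on the two faces `x i = 0` and `x i = m` of the grid, then in some small cube each `P i`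
takes both values. -/
theorem exists_cube_forall_exists_and_exists_not {n m : ℕ} (hm : m ≠ 0)
    (P : Fin n → (Fin n → ℕ) → Prop)
    (h0 : ∀ i x, x i = 0 → ¬ P i x) (hP : ∀ i x, x i = m → P i x) :
    ∃ v : Fin n → ℕ, (∀ i, v i < m) ∧ ∀ i, (∃ x, (∀ j, v j ≤ x j ∧ x j ≤ v j + 1) ∧ P i x) ∧
      ∃ x, (∀ j, v j ≤ x j ∧ x j ≤ v j + 1) ∧ ¬ P i x := by
  classical
  set G : Fin n → (Fin n → ℕ) → ℤ := fun i x => if P i x then 1 else 0 with hG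
  have hne : totalVol m G ≠ 0 := by
    rw [totalVol_congr G (stepFun n) (fun i x hx => by simp [hG, h0 i x hx])
      (fun i x hx => by simp [hG, hP i x hx]) (fun i x hx => by simp [stepFun, hx])
      (fun i x hx => by simp [stepFun, hx, hm]), totalVol_stepFun hm]
    exact_mod_cast n.factorial_ne_zero
  obtain ⟨v, hv, hne⟩ := Finset.exists_ne_zero_of_sum_ne_zero hne
  obtain ⟨τ, -, hne⟩ := Finset.exists_ne_zero_of_sum_ne_zero hne
  have hdet : (volMatrix G (kuhnVertex v τ)).det ≠ 0 := right_ne_zero_of_mul hne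
  have hcube : ∀ k j, v j ≤ kuhnVertex v τ k j ∧ kuhnVertex v τ k j ≤ v j + 1 := by
    intro k j
    simp only [kuhnVertex]
    split_ifs <;> omega
  refine ⟨v, fun i => by simpa using Fintype.mem_piFinset.1 hv i, fun i => ⟨?_, ?_⟩⟩
  · by_contra! h
    refine hdet (Matrix.det_eq_zero_of_row_eq_zero i.succ fun k => ?_)
    simp [volMatrix, hG, h _ (hcube k)]
  · by_contra! h
    refine hdet (Matrix.det_zero_of_row_eq (Fin.succ_ne_zero i) ?_)
    ext k
    simp [volMatrix, hG, h _ (hcube k)]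

/-! ### Zero-dimensional spaces and the countable sum theorem -/

/-- The small inductive dimension is monotone. -/
lemma Topology.IsInducing.hasSmallInductiveDimensionLT {X : Type*} {Y : Type*} [TopologicalSpace X]
    [TopologicalSpace Y] {f : X → Y} (hf : IsInducing f) {n : ℕ}
    (h : HasSmallInductiveDimensionLT Y n) : HasSmallInductiveDimensionLT X n := by
  induction n generalizing X Y with
  | zero =>
    rw [hasSmallInductiveDimensionLT_zero_iff] at h ⊢
    exact Function.isEmpty f
  | succ n ih =>
    cases h with
    | succ _ s hs h =>
      refine .succ n _ (hs.isInducing hf) ?_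
      rintro _ ⟨U, hU, rfl⟩
      have hmaps : MapsTo f (frontier (f ⁻¹' U)) (frontier U) :=
        fun x hx => hf.continuous.frontier_preimage_subset U hx
      refine ih (f := hmaps.restrict) ?_ (h U hU)
      exact .of_comp (hf.continuous.restrict hmaps) continuous_subtype_val
        (hf.comp IsInducing.subtypeVal)

lemma hasSmallInductiveDimensionLT_one_iff_forall_isOpen {X : Type*} [TopologicalSpace X] :
    HasSmallInductiveDimensionLT X 1 ↔
      ∀ U : Set X, IsOpen U → ∀ x ∈ U, ∃ W : Set X, IsClopen W ∧ x ∈ W ∧ W ⊆ U := by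
  rw [hasSmallInductiveDimensionLT_one_iff]
  constructor
  · intro h U hU x hx
    obtain ⟨W, hW, hxW, hWU⟩ := h.exists_subset_of_mem_open hx hU
    exact ⟨W, hW, hxW, hWU⟩
  · intro h
    refine isTopologicalBasis_of_isOpen_of_nhds (fun u hu => hu.isOpen) fun x U hx hU => ?_
    obtain ⟨W, hW, hxW, hWU⟩ := h U hU x hx
    exact ⟨W, hW, hxW, hWU⟩

section ZeroDim

variable {X : Type*} [TopologicalSpace X]

lemma exists_isOpen_disjoint_closure [NormalSpace X] {A B : Set X} (hA : IsClosed A)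
    (hB : IsClosed B) (hAB : Disjoint A B) :
    ∃ U V : Set X, IsOpen U ∧ IsOpen V ∧ A ⊆ U ∧ B ⊆ V ∧ Disjoint (closure U) (closure V) := by
  obtain ⟨U, hU, hAU, hUB⟩ := normal_exists_closure_subset hA hB.isOpen_compl
    (subset_compl_iff_disjoint_right.2 hAB)
  obtain ⟨V, hV, hBV, hVU⟩ := normal_exists_closure_subset hB isClosed_closure.isOpen_compl
    (subset_compl_comm.1 hUB)
  exact ⟨U, V, hU, hV, hAU, hBV, (subset_compl_iff_disjoint_right.1 hVU).symm⟩

/-- In a zero-dimensional second countable space, disjoint closed sets are separated by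
a clopen set. -/
lemma exists_isClopen_of_disjoint [SecondCountableTopology X]
    (h : HasSmallInductiveDimensionLT X 1) {A B : Set X} (hA : IsClosed A) (hB : IsClosed B)
    (hAB : Disjoint A B) : ∃ W : Set X, IsClopen W ∧ A ⊆ W ∧ Disjoint W B := by
  rw [hasSmallInductiveDimensionLT_one_iff_forall_isOpen] at h
  have h1 : ∀ x, ∃ W : Set X, IsClopen W ∧ x ∈ W ∧ (Disjoint W A ∨ Disjoint W B) := by
    intro x
    by_cases hx : x ∈ A
    · obtain ⟨W, hW, hxW, hWB⟩ := h Bᶜ hB.isOpen_compl x (disjoint_left.1 hAB hx)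
      exact ⟨W, hW, hxW, .inr (disjoint_left.2 hWB)⟩
    · obtain ⟨W, hW, hxW, hWA⟩ := h Aᶜ hA.isOpen_compl x hx
      exact ⟨W, hW, hxW, .inl (disjoint_left.2 hWA)⟩
  choose W hW hxW hWd using h1
  obtain ⟨T, hT, hTU⟩ := isOpen_iUnion_countable W fun x => (hW x).isOpen
  have hcov : ∀ x, ∃ t ∈ T, x ∈ W t := by
    intro x
    have : x ∈ ⋃ i ∈ T, W i := hTU ▸ mem_iUnion.2 ⟨x, hxW x⟩
    simpa using this
  rcases T.eq_empty_or_nonempty with rfl | hne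
  · refine ⟨∅, isClopen_empty, fun x _ => ?_, empty_disjoint _⟩
    simpa using hcov x
  obtain ⟨e, rfl⟩ := hT.exists_eq_range hne
  set D : ℕ → Set X := disjointed fun k => W (e k) with hD
  have hDo : ∀ k, IsOpen (D k) := by
    intro k
    refine disjointedRec (f := fun k => W (e k)) (p := IsOpen) (fun t i ht => ?_) (hW _).isOpen
    exact ht.sdiff (hW _).isClosed
  have hDcov : ∀ x, ∃ k, x ∈ D k := by
    intro x
    have : x ∈ ⋃ k, D k := by
      rw [hD, iUnion_disjointed]
      simpa using hcov x
    simpa using this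
  have hDsub : ∀ k, D k ⊆ W (e k) := disjointed_subset _
  refine ⟨⋃ k ∈ {k | Disjoint (W (e k)) B}, D k, ⟨?_, ?_⟩, ?_, ?_⟩
  · rw [← isOpen_compl_iff]
    have : (⋃ k ∈ {k | Disjoint (W (e k)) B}, D k)ᶜ = ⋃ k ∈ {k | ¬ Disjoint (W (e k)) B}, D k := by
      ext x
      obtain ⟨k, hk⟩ := hDcov x
      have huniq : ∀ l, x ∈ D l → l = k := fun l hl => by
        by_contra hne
        exact disjoint_left.1 (disjoint_disjointed (fun k => W (e k)) hne) hl hk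
      simp only [mem_compl_iff, mem_iUnion, mem_ofPred_eq, exists_prop, not_exists, not_and]
      constructor
      · exact fun h => ⟨k, fun hd => h k hd hk, hk⟩
      · rintro ⟨l, hl, hxl⟩ l' hl' hxl'
        rw [huniq l hxl] at hl
        rw [huniq l' hxl'] at hl'
        exact hl hl'
    rw [this]
    exact isOpen_biUnion fun k _ => hDo k
  · exact isOpen_biUnion fun k _ => hDo k
  · intro x hx
    obtain ⟨k, hk⟩ := hDcov x
    refine mem_biUnion ?_ hk
    exact (hWd (e k)).resolve_left fun hd => disjoint_left.1 hd (hDsub k hk) hx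
  · simp only [disjoint_iUnion_left]
    exact fun k hk => hk.mono_left (hDsub k)

/-- A zero-dimensional subspace can be avoided by a partition between disjoint closed sets. -/
lemma exists_isOpen_cover_of_zeroDim [SecondCountableTopology X] [CompletelyNormalSpace X]
    {Z : Set X} (hZ : HasSmallInductiveDimensionLT Z 1) {A B : Set X} (hA : IsClosed A)
    (hB : IsClosed B) (hAB : Disjoint A B) :
    ∃ U V : Set X, IsOpen U ∧ IsOpen V ∧ A ⊆ U ∧ B ⊆ V ∧ Disjoint U V ∧ Z ⊆ U ∪ V := by
  obtain ⟨U₁, V₁, hU₁, hV₁, hAU, hBV, hUV⟩ := exists_isOpen_disjoint_closure hA hB hAB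
  obtain ⟨W, hW, hUW, hWV⟩ := exists_isClopen_of_disjoint hZ
    (isClosed_closure.preimage continuous_subtype_val (t := closure U₁))
    (isClosed_closure.preimage continuous_subtype_val (t := closure V₁)) (hUV.preimage _)
  have hZA : Disjoint A ((↑) '' Wᶜ : Set X) := by
    rw [disjoint_left]
    rintro _ hx ⟨z, hz, rfl⟩
    exact hz (hUW (subset_closure (hAU hx)))
  have hUZ : Disjoint U₁ ((↑) '' Wᶜ : Set X) := by
    rw [disjoint_left]
    rintro _ hx ⟨z, hz, rfl⟩
    exact hz (hUW (subset_closure hx))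
  have hVZ : Disjoint V₁ ((↑) '' W : Set X) := by
    rw [disjoint_left]
    rintro _ hx ⟨z, hz, rfl⟩
    exact disjoint_left.1 hWV hz (subset_closure hx)
  have hclopen : ∀ W : Set Z, IsClosed W → Disjoint (closure ((↑) '' W : Set X)) ((↑) '' Wᶜ) := by
    intro W hW
    rw [disjoint_left]
    rintro _ hx ⟨z, hz, rfl⟩
    rw [← closure_subtype, hW.closure_eq] at hx
    exact hz hx
  have hsep : Disjoint (closure (A ∪ (↑) '' W)) (B ∪ (↑) '' Wᶜ) := by
    rw [closure_union, hA.closure_eq, disjoint_union_left, disjoint_union_right,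
      disjoint_union_right]
    refine ⟨⟨hAB, hZA⟩, ?_, hclopen W hW.isClosed⟩
    exact ((hVZ.closure_right hV₁).mono_left hBV).symm
  have hsep' : Disjoint (A ∪ (↑) '' W) (closure (B ∪ (↑) '' Wᶜ)) := by
    rw [closure_union, hB.closure_eq, disjoint_union_left, disjoint_union_right,
      disjoint_union_right]
    refine ⟨⟨hAB, ?_⟩, (hVZ.mono_left hBV).symm, ?_⟩
    · exact (hUZ.closure_right hU₁).mono_left hAU
    · have := hclopen Wᶜ hW.compl.isClosed
      rw [compl_compl] at this
      exact this.symm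
  obtain ⟨U, V, hU, hV, hAU', hBV', hd⟩ := separatedNhds_iff_disjoint.2
    (CompletelyNormalSpace.completely_normal hsep hsep')
  refine ⟨U, V, hU, hV, subset_union_left.trans hAU', subset_union_left.trans hBV', hd, ?_⟩
  intro z hz
  by_cases hzW : (⟨z, hz⟩ : Z) ∈ W
  · exact .inl (hAU' (.inr ⟨_, hzW, rfl⟩))
  · exact .inr (hBV' (.inr ⟨_, hzW, rfl⟩))

/-- One step of the sum theorem: a closed zero-dimensional set is added to the part of the space
that is already divided. -/
lemma exists_isClosed_extension [SecondCountableTopology X] [CompletelyNormalSpace X]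
    {F : Set X} (hFc : IsClosed F) (hF : HasSmallInductiveDimensionLT F 1) {A B : Set X}
    (hA : IsClosed A) (hB : IsClosed B) (hAB : Disjoint A B) :
    ∃ A' B' : Set X, IsClosed A' ∧ IsClosed B' ∧ Disjoint A' B' ∧ A ⊆ interior A' ∧
      B ⊆ interior B' ∧ F ⊆ A' ∪ B' := by
  obtain ⟨U, V, hU, hV, hAU, hBV, hUV, hFUV⟩ := exists_isOpen_cover_of_zeroDim hF hA hB hAB
  have h1 : Disjoint (A ∪ F \ V) (B ∪ F \ U) := by
    rw [disjoint_union_left, disjoint_union_right, disjoint_union_right]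
    refine ⟨⟨hAB, ?_⟩, ?_, ?_⟩
    · exact disjoint_left.2 fun x hx hx' => hx'.2 (hAU hx)
    · exact disjoint_left.2 fun x hx hx' => hx.2 (hBV hx')
    · exact disjoint_left.2 fun x hx hx' => (hFUV hx.1).elim hx'.2 hx.2
  obtain ⟨U', V', hU', hV', hAU', hBV', hd⟩ := exists_isOpen_disjoint_closure
    (hA.union (hFc.sdiff hV)) (hB.union (hFc.sdiff hU)) h1
  refine ⟨closure U', closure V', isClosed_closure, isClosed_closure, hd,
    (subset_union_left.trans hAU').trans hU'.subset_interior_closure,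
    (subset_union_left.trans hBV').trans hV'.subset_interior_closure, fun x hx => ?_⟩
  by_cases hxV : x ∈ V
  · exact .inr (subset_closure (hBV' (.inr ⟨hx, fun hxU => disjoint_left.1 hUV hxU hxV⟩)))
  · exact .inl (subset_closure (hAU' (.inr ⟨hx, hxV⟩)))

/-- The countable sum theorem in dimension zero. -/
lemma zeroDim_of_iUnion [SecondCountableTopology X] [CompletelyNormalSpace X] [T1Space X]
    (F : ℕ → Set X) (hFc : ∀ k, IsClosed (F k))
    (hF : ∀ k, HasSmallInductiveDimensionLT (F k) 1) (hU : ⋃ k, F k = univ) :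
    HasSmallInductiveDimensionLT X 1 := by
  rw [hasSmallInductiveDimensionLT_one_iff_forall_isOpen]
  intro O hO x hx
  let S := {p : Set X × Set X // IsClosed p.1 ∧ IsClosed p.2 ∧ Disjoint p.1 p.2}
  have hstep : ∀ (k : ℕ) (p : S), ∃ q : S, p.1.1 ⊆ interior q.1.1 ∧ p.1.2 ⊆ interior q.1.2 ∧
      F k ⊆ q.1.1 ∪ q.1.2 := by
    rintro k ⟨⟨A, B⟩, hA, hB, hAB⟩
    obtain ⟨A', B', h1, h2, h3, h4, h5, h6⟩ := exists_isClosed_extension (hFc k) (hF k) hA hB hAB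
    exact ⟨⟨⟨A', B'⟩, h1, h2, h3⟩, h4, h5, h6⟩
  choose next hn1 hn2 hn3 using hstep
  let p₀ : S := ⟨({x}, Oᶜ), isClosed_singleton, hO.isClosed_compl, by simpa using hx⟩
  let s : ℕ → S := fun k => Nat.rec p₀ (fun k p => next k p) k
  have hs : ∀ k, s (k + 1) = next k (s k) := fun k => rfl
  have hm1 : Monotone fun k => (s k).1.1 :=
    monotone_nat_of_le_succ fun k => (hs k ▸ hn1 k (s k)).trans interior_subset
  have hm2 : Monotone fun k => (s k).1.2 :=
    monotone_nat_of_le_succ fun k => (hs k ▸ hn2 k (s k)).trans interior_subset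
  have ho1 : IsOpen (⋃ k, (s k).1.1) := by
    have : ⋃ k, (s k).1.1 = ⋃ k, interior (s k).1.1 := by
      refine subset_antisymm (iUnion_subset fun k => ?_) (iUnion_mono fun k => interior_subset)
      exact (hs k ▸ hn1 k (s k)).trans (subset_iUnion (fun k => interior (s k).1.1) (k + 1))
    rw [this]
    exact isOpen_iUnion fun k => isOpen_interior
  have ho2 : IsOpen (⋃ k, (s k).1.2) := by
    have : ⋃ k, (s k).1.2 = ⋃ k, interior (s k).1.2 := by
      refine subset_antisymm (iUnion_subset fun k => ?_) (iUnion_mono fun k => interior_subset)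
      exact (hs k ▸ hn2 k (s k)).trans (subset_iUnion (fun k => interior (s k).1.2) (k + 1))
    rw [this]
    exact isOpen_iUnion fun k => isOpen_interior
  have hd : Disjoint (⋃ k, (s k).1.1) (⋃ k, (s k).1.2) := by
    simp only [disjoint_iUnion_left, disjoint_iUnion_right]
    intro k l
    exact Disjoint.mono (hm1 (le_max_left l k)) (hm2 (le_max_right l k)) (s (max l k)).2.2.2
  have hcov : (⋃ k, (s k).1.1)ᶜ = ⋃ k, (s k).1.2 := by
    refine subset_antisymm (fun y hy => ?_) (subset_compl_iff_disjoint_left.2 hd)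
    obtain ⟨k, hk⟩ := mem_iUnion.1 (hU ▸ mem_univ y)
    rcases hn3 k (s k) hk with h | h
    · exact absurd (mem_iUnion.2 ⟨k + 1, h⟩) hy
    · exact mem_iUnion.2 ⟨k + 1, h⟩
  refine ⟨⋃ k, (s k).1.1, ⟨⟨hcov ▸ ho2⟩, ho1⟩, mem_iUnion.2 ⟨0, rfl⟩, fun y hy => ?_⟩
  by_contra hyO
  exact disjoint_left.1 hd hy (mem_iUnion.2 ⟨0, hyO⟩)

end ZeroDim

/-! ### Decomposition into zero-dimensional subspaces and the dimension of the cube -/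

section Decomposition

variable {X : Type*} [TopologicalSpace X]

/-- A set that is covered by `n` zero-dimensional subspaces. -/
def IsZeroDimUnion (n : ℕ) (S : Set X) : Prop :=
  ∃ Z : Fin n → Set X, (∀ i, HasSmallInductiveDimensionLT (Z i) 1) ∧ S ⊆ ⋃ i, Z i

lemma HasSmallInductiveDimensionLT.subset {n : ℕ} {S T : Set X}
    (h : HasSmallInductiveDimensionLT T n) (hST : S ⊆ T) : HasSmallInductiveDimensionLT S n :=
  (IsEmbedding.inclusion hST).isInducing.hasSmallInductiveDimensionLT h

/-- A relative form of the countable sum theorem in dimension zero. -/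
lemma zeroDim_of_subset_iUnion [SecondCountableTopology X] [CompletelyNormalSpace X] [T1Space X]
    {ι : Type*} [Countable ι] (Z : Set X) (C : ι → Set X) (hC : ∀ k, IsClosed (C k))
    (hZ : ∀ k, HasSmallInductiveDimensionLT (Z ∩ C k : Set X) 1) (hU : Z ⊆ ⋃ k, C k) :
    HasSmallInductiveDimensionLT Z 1 := by
  rcases isEmpty_or_nonempty ι with h | h
  · have : IsEmpty Z := by
      rw [isEmpty_coe_sort, ← subset_empty_iff]
      simpa using hU
    infer_instance
  obtain ⟨e, he⟩ := exists_surjective_nat ι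
  refine zeroDim_of_iUnion (fun k => ((↑) : Z → X) ⁻¹' C (e k))
    (fun k => (hC _).preimage continuous_subtype_val) (fun k => ?_) ?_
  · have hmaps : ∀ x : ((↑) : Z → X) ⁻¹' C (e k), (x : X) ∈ Z ∩ C (e k) := fun x => ⟨x.1.2, x.2⟩
    refine IsInducing.hasSmallInductiveDimensionLT (f := fun x => ⟨_, hmaps x⟩) ?_ (hZ (e k))
    have hval : IsInducing fun x : ((↑) : Z → X) ⁻¹' C (e k) => ((x : Z) : X) :=
      IsInducing.subtypeVal.comp IsInducing.subtypeVal
    exact .of_comp (by fun_prop) continuous_subtype_val hval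
  · refine eq_univ_of_forall fun x => ?_
    obtain ⟨k, hk⟩ := mem_iUnion.1 (hU x.2)
    obtain ⟨l, rfl⟩ := he k
    exact mem_iUnion.2 ⟨l, hk⟩

/-- The countable sum theorem for unions of `n` zero-dimensional subspaces. -/
lemma IsZeroDimUnion.iUnion {X : Type*} [MetricSpace X] [SecondCountableTopology X] {n : ℕ}
    (F : ℕ → Set X) (hFc : ∀ k, IsClosed (F k)) (hF : ∀ k, IsZeroDimUnion n (F k)) :
    IsZeroDimUnion n (⋃ k, F k) := by
  choose Z hZ hFZ using hF
  -- The differences `K k` are disjoint `Fσ` sets.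
  set K : ℕ → Set X := disjointed F with hK
  have hKσ : ∀ k, ∃ C : ℕ → Set X, (∀ l, IsClosed (C l)) ∧ ⋃ l, C l = K k := by
    intro k
    have hop : IsOpen (⋂ j < k, (F j)ᶜ) :=
      (finite_lt_nat k).isOpen_biInter fun j _ => (hFc j).isOpen_compl
    obtain ⟨C, hC, -, hCU, -⟩ := hop.exists_iUnion_isClosed
    refine ⟨fun l => F k ∩ C l, fun l => (hFc k).inter (hC l), ?_⟩
    rw [← inter_iUnion, hCU, hK, disjointed_eq_inter_compl]
  choose C hC hCK using hKσ
  have hKsub : ∀ k, K k ⊆ F k := disjointed_subset F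
  refine ⟨fun i => ⋃ k, Z k i ∩ K k, fun i => ?_, ?_⟩
  · refine zeroDim_of_subset_iUnion _ (fun p : ℕ × ℕ => C p.1 p.2) (fun p => hC _ _) ?_ ?_
    · rintro ⟨k, l⟩
      refine (hZ k i).subset ?_
      rintro x ⟨hx, hxC⟩
      obtain ⟨k', hx, hxK⟩ := mem_iUnion.1 hx
      have hxk : x ∈ K k := hCK k ▸ mem_iUnion.2 ⟨l, hxC⟩
      have : k' = k := by
        by_contra hne
        exact disjoint_left.1 (disjoint_disjointed F hne) hxK hxk
      exact this ▸ hx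
    · intro x hx
      obtain ⟨k, -, hxK⟩ := mem_iUnion.1 hx
      rw [← hCK k] at hxK
      obtain ⟨l, hl⟩ := mem_iUnion.1 hxK
      exact mem_iUnion.2 ⟨(k, l), hl⟩
  · rw [← iUnion_disjointed]
    intro x hx
    obtain ⟨k, hk⟩ := mem_iUnion.1 hx
    obtain ⟨i, hi⟩ := mem_iUnion.1 (hFZ k (hKsub k hk))
    exact mem_iUnion.2 ⟨i, mem_iUnion.2 ⟨k, hi, hk⟩⟩

/-- The decomposition theorem: a separable metric space of dimension less than `n` is a union of
`n` zero-dimensional subspaces. -/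
theorem HasSmallInductiveDimensionLT.isZeroDimUnion {X : Type*} [MetricSpace X]
    [SecondCountableTopology X] {n : ℕ} (h : HasSmallInductiveDimensionLT X n) :
    IsZeroDimUnion n (univ : Set X) := by
  induction n generalizing X with
  | zero =>
    rw [hasSmallInductiveDimensionLT_zero_iff] at h
    exact ⟨fun i => i.elim0, fun i => i.elim0, fun x => h.elim x⟩
  | succ n ih =>
    cases h with
    | succ _ s hs h =>
    obtain ⟨s', hs's, hs'c, hs'⟩ := hs.exists_countable
    have hfr : ∀ U ∈ s', IsZeroDimUnion n (frontier U) := by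
      intro U hU
      obtain ⟨Z, hZ, hcov⟩ := ih (h U (hs's hU))
      refine ⟨fun i => (↑) '' Z i, fun i => ?_, fun x hx => ?_⟩
      · exact (IsEmbedding.subtypeVal.homeomorphImage
          (Z i)).symm.isInducing.hasSmallInductiveDimensionLT (hZ i)
      · obtain ⟨i, hi⟩ := mem_iUnion.1 (hcov (mem_univ (⟨x, hx⟩ : frontier U)))
        exact mem_iUnion.2 ⟨i, ⟨x, hx⟩, hi, rfl⟩
    obtain ⟨e, he⟩ := (hs'c.insert ∅).exists_eq_range (insert_nonempty _ _)
    have hY : IsZeroDimUnion n (⋃ k, frontier (e k)) := by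
      refine .iUnion _ (fun k => isClosed_frontier) fun k => ?_
      rcases (he ▸ mem_range_self k : e k ∈ insert ∅ s') with h0 | h1
      · obtain rfl | n := n
        · exact ⟨fun i => i.elim0, fun i => i.elim0, by simp [h0]⟩
        · exact ⟨fun _ => ∅, fun _ => inferInstance, by simp [h0]⟩
      · exact hfr _ h1
    obtain ⟨Z, hZ, hYZ⟩ := hY
    refine ⟨Fin.cons (⋃ k, frontier (e k))ᶜ Z, fun i => ?_, fun x _ => ?_⟩
    · refine Fin.cases ?_ (fun j => ?_) i
      · rw [Fin.cons_zero, hasSmallInductiveDimensionLT_one_iff_forall_isOpen]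
        intro O hO x hx
        obtain ⟨O', hO', rfl⟩ := isOpen_induced_iff.1 hO
        obtain ⟨U, hU, hxU, hUO⟩ := hs'.exists_subset_of_mem_open hx hO'
        refine ⟨Subtype.val ⁻¹' U, ⟨?_, (hs'.isOpen hU).preimage continuous_subtype_val⟩, hxU,
          preimage_mono hUO⟩
        -- The boundary of `U` has been removed.
        have : (Subtype.val ⁻¹' U : Set ((⋃ k, frontier (e k))ᶜ : Set X)) =
            Subtype.val ⁻¹' closure U := by
          ext ⟨y, hy⟩
          refine ⟨fun h => subset_closure h, fun h => ?_⟩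
          by_contra hyU
          obtain ⟨k, hk⟩ := (he ▸ mem_insert_of_mem ∅ hU : U ∈ range e)
          refine hy (mem_iUnion.2 ⟨k, ?_⟩)
          rw [hk, (hs'.isOpen hU).frontier_eq]
          exact ⟨h, hyU⟩
        rw [this]
        exact isClosed_closure.preimage continuous_subtype_val
      · rw [Fin.cons_succ]; exact hZ j
    · by_cases hx : x ∈ ⋃ k, frontier (e k)
      · obtain ⟨i, hi⟩ := mem_iUnion.1 (hYZ hx)
        exact mem_iUnion.2 ⟨i.succ, hi⟩
      · exact mem_iUnion.2 ⟨0, hx⟩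

end Decomposition

section Cube

/-- In the cube, partitions between the pairs of opposite faces have a common point. -/
theorem exists_notMem_of_separates_faces {n : ℕ} (U V : Fin n → Set (Fin n → unitInterval))
    (hU : ∀ i, IsOpen (U i)) (hV : ∀ i, IsOpen (V i)) (hUV : ∀ i, Disjoint (U i) (V i))
    (h0 : ∀ i, {x | x i = 0} ⊆ U i) (h1 : ∀ i, {x | x i = 1} ⊆ V i) :
    ∃ x, ∀ i, x ∉ U i ∧ x ∉ V i := by
  let pt : ℕ → (Fin n → ℕ) → Fin n → unitInterval := fun m x i =>
    projIcc 0 1 zero_le_one ((x i : ℝ) / (m + 1))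
  have key : ∀ m : ℕ, ∃ a : Fin n → unitInterval, ∀ i,
      (∃ y, dist y a ≤ 1 / ((m : ℝ) + 1) ∧ y ∉ U i) ∧
      (∃ y, dist y a ≤ 1 / ((m : ℝ) + 1) ∧ y ∈ U i) := by
    intro m
    have hpos : (0 : ℝ) < m + 1 := by positivity
    obtain ⟨v, -, hv⟩ := exists_cube_forall_exists_and_exists_not (n := n) (m := m + 1) (by simp)
      (fun i x => pt m x ∉ U i) (fun i x hx => by
        simp only [not_not]
        refine h0 i ?_
        simp [pt, hx])
      (fun i x hx hxU => by
        refine disjoint_left.1 (hUV i) hxU (h1 i ?_)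
        simp only [pt, mem_ofPred_eq, hx]
        push_cast
        rw [div_self hpos.ne']
        exact projIcc_right _)
    have hd : ∀ x : Fin n → ℕ, (∀ j, v j ≤ x j ∧ x j ≤ v j + 1) →
        dist (pt m x) (pt m v) ≤ 1 / ((m : ℝ) + 1) := by
      intro x hx
      rw [dist_pi_le_iff (by positivity)]
      intro j
      refine ((LipschitzWith.projIcc (zero_le_one' ℝ)).dist_le_mul _ _).trans ?_
      have h1 : (v j : ℝ) ≤ x j := by exact_mod_cast (hx j).1
      have h2 : (x j : ℝ) ≤ v j + 1 := by exact_mod_cast (hx j).2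
      rw [NNReal.coe_one, one_mul, Real.dist_eq, ← sub_div, abs_div, abs_of_pos hpos,
        abs_of_nonneg (by linarith)]
      gcongr
      linarith
    refine ⟨pt m v, fun i => ?_⟩
    obtain ⟨⟨x, hx, hxU⟩, ⟨y, hy, hyU⟩⟩ := hv i
    exact ⟨⟨_, hd x hx, hxU⟩, ⟨_, hd y hy, not_not.1 hyU⟩⟩
  choose a ha using key
  obtain ⟨x, φ, hφ, hx⟩ := CompactSpace.tendsto_subseq a
  have hlim : ∀ y : ℕ → Fin n → unitInterval, (∀ m, dist (y m) (a m) ≤ 1 / ((m : ℝ) + 1)) →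
      Filter.Tendsto (y ∘ φ) Filter.atTop (𝓝 x) := by
    intro y hy
    refine hx.congr_dist ?_
    refine squeeze_zero (fun _ => dist_nonneg) (fun k => ?_)
      (tendsto_one_div_add_atTop_nhds_zero_nat.comp hφ.tendsto_atTop)
    rw [dist_comm]
    exact hy (φ k)
  refine ⟨x, fun i => ⟨?_, fun hxV => ?_⟩⟩
  · choose y hy hyU using fun m => (ha m i).1
    exact (hU i).isClosed_compl.mem_of_tendsto (hlim y hy) (.of_forall fun k => hyU _)
  · choose y hy hyU using fun m => (ha m i).2
    obtain ⟨k, hk⟩ := ((hlim y hy).eventually ((hV i).mem_nhds hxV)).exists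
    exact disjoint_left.1 (hUV i) (hyU _) hk

/-- The cube `[0, 1]ⁿ` has dimension at least `n`. -/
theorem not_hasSmallInductiveDimensionLT_cube (n : ℕ) :
    ¬ HasSmallInductiveDimensionLT (Fin n → unitInterval) n := by
  intro h
  obtain ⟨Z, hZ, hcov⟩ := h.isZeroDimUnion
  have h1 : ∀ i, ∃ U V : Set (Fin n → unitInterval), IsOpen U ∧ IsOpen V ∧ {x | x i = 0} ⊆ U ∧
      {x | x i = 1} ⊆ V ∧ Disjoint U V ∧ Z i ⊆ U ∪ V := fun i =>
    exists_isOpen_cover_of_zeroDim (hZ i) (isClosed_eq (continuous_apply i) continuous_const)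
      (isClosed_eq (continuous_apply i) continuous_const)
      (disjoint_left.2 fun x (hx : x i = 0) (hx' : x i = 1) => zero_ne_one (hx.symm.trans hx'))
  choose U V hU hV h0 h1 hUV hZUV using h1
  obtain ⟨x, hx⟩ := exists_notMem_of_separates_faces U V hU hV hUV h0 h1
  obtain ⟨i, hi⟩ := mem_iUnion.1 (hcov (mem_univ x))
  exact (hZUV i hi).elim (hx i).1 (hx i).2

end Cube

/-! ### Level sets of Lipschitz functions -/

section LevelSets

open MeasureTheory Measure Metric Filter

/-- A weak form of Eilenberg's inequality: if the `s`-dimensional Hausdorff measure of `X`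
vanishes, then the `(s - 1)`-dimensional Hausdorff measure of almost every level set vanishes. -/
lemma ae_hausdorffMeasure_levelSet_eq_zero {X : Type*} [MetricSpace X] [MeasurableSpace X]
    [BorelSpace X] {f : X → ℝ} (hf : LipschitzWith 1 f) {s : ℝ} (hs : 1 ≤ s)
    (h : μH[s] (univ : Set X) = 0) : ∀ᵐ r : ℝ, μH[s - 1] (f ⁻¹' {r}) = 0 := by
  have hs0 : 0 ≤ s - 1 := by linarith
  have hcov : ∀ n : ℕ, ∃ t : ℕ → Set X, univ ⊆ ⋃ i, t i ∧ (∀ i, ediam (t i) ≤ ((n : ℝ≥0∞) + 1)⁻¹) ∧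
      ∑' i, ⨆ (_ : (t i).Nonempty), ediam (t i) ^ s < 2⁻¹ ^ n := by
    intro n
    have hr : (0 : ℝ≥0∞) < ((n : ℝ≥0∞) + 1)⁻¹ :=
      ENNReal.inv_pos.2 (ENNReal.add_ne_top.2 ⟨ENNReal.natCast_ne_top n, ENNReal.one_ne_top⟩)
    rw [hausdorffMeasure_apply, ← nonpos_iff_eq_zero] at h
    have h1 := (le_iSup₂ _ hr).trans h
    have h2 : (0 : ℝ≥0∞) < 2⁻¹ ^ n := ENNReal.pow_pos (by simp) n
    have h3 := h1.trans_lt h2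
    simp only [iInf_lt_iff] at h3
    obtain ⟨t, ht, htd, hsum⟩ := h3
    exact ⟨t, ht, htd, hsum⟩
  choose t htU htd hts using hcov
  set φ : ℕ → ℝ → ℝ≥0∞ := fun n r =>
    ∑' i, (closure (f '' t n i)).indicator (fun _ => ediam (t n i) ^ (s - 1)) r with hφ
  have hmeas : ∀ n i, Measurable
      ((closure (f '' t n i)).indicator fun _ : ℝ => ediam (t n i) ^ (s - 1)) :=
    fun n i => measurable_const.indicator isClosed_closure.measurableSet
  have hint : ∀ n, ∫⁻ r, φ n r ≤ 2⁻¹ ^ n := by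
    intro n
    rw [lintegral_tsum fun i => (hmeas n i).aemeasurable]
    refine (ENNReal.tsum_le_tsum fun i => ?_).trans (hts n).le
    rw [lintegral_indicator_const isClosed_closure.measurableSet]
    rcases (t n i).eq_empty_or_nonempty with he | hne
    · simp [he]
    · rw [iSup_pos hne]
      have hv : volume (closure (f '' t n i)) ≤ ediam (t n i) := by
        refine (Real.volume_le_diam _).trans ?_
        rw [ediam_closure]
        simpa using hf.ediam_image_le (t n i)
      calc ediam (t n i) ^ (s - 1) * volume (closure (f '' t n i))
          ≤ ediam (t n i) ^ (s - 1) * ediam (t n i) := by gcongr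
        _ = ediam (t n i) ^ (s - 1) * ediam (t n i) ^ (1 : ℝ) := by rw [ENNReal.rpow_one]
        _ = ediam (t n i) ^ s := by
          rw [← ENNReal.rpow_add_of_nonneg _ _ hs0 zero_le_one, sub_add_cancel]
  have hφm : ∀ n, Measurable (φ n) := fun n => Measurable.tsum (hmeas n)
  have hfin : ∫⁻ r, ∑' n, φ n r ≠ ⊤ := by
    rw [lintegral_tsum fun n => (hφm n).aemeasurable]
    refine ne_top_of_le_ne_top ?_ (ENNReal.tsum_le_tsum hint)
    rw [ENNReal.tsum_geometric]
    simp
  filter_upwards [ae_lt_top (Measurable.tsum hφm) hfin] with r hr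
  have hlim := ENNReal.tendsto_atTop_zero_of_tsum_ne_top hr.ne
  rw [← nonpos_iff_eq_zero, ← hlim.liminf_eq]
  refine (hausdorffMeasure_le_liminf_tsum (ι := fun n => {i // r ∈ closure (f '' t n i)}) (s - 1)
    (f ⁻¹' {r}) (l := atTop) (fun n : ℕ => ((n : ℝ≥0∞) + 1)⁻¹) ?_ (fun n i => t n i)
    (.of_forall fun n i => htd n i) (.of_forall fun n x hx => ?_)).trans_eq ?_
  · have := (ENNReal.tendsto_inv_nat_nhds_zero).comp (tendsto_add_atTop_nat 1)
    simpa [Function.comp_def] using this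
  · obtain ⟨i, hi⟩ := mem_iUnion.1 (htU n (mem_univ x))
    exact mem_iUnion.2 ⟨⟨i, subset_closure ⟨x, hi, hx⟩⟩, hi⟩
  · congr 1
    funext n
    rw [hφ]
    exact tsum_subtype {i | r ∈ closure (f '' t n i)} fun i => ediam (t n i) ^ (s - 1)

/-- Almost every non-empty level set of a Lipschitz function has a Hausdorff dimension that is
smaller by at least one. -/
theorem ae_dimH_levelSet {X : Type*} [MetricSpace X] {f : X → ℝ} (hf : LipschitzWith 1 f) :
    ∀ᵐ r : ℝ, f ⁻¹' {r} = ∅ ∨ dimH (f ⁻¹' {r}) + 1 ≤ dimH (univ : Set X) := by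
  borelize X
  rcases eq_or_ne (dimH (univ : Set X)) ⊤ with htop | htop
  · exact .of_forall fun r => .inr (htop ▸ le_top)
  lift dimH (univ : Set X) to NNReal using htop with D hD
  rcases lt_or_ge D 1 with h1 | h1
  · have h0 : μH[(1 : ℝ)] (univ : Set X) = 0 := by
      have := hausdorffMeasure_of_dimH_lt (s := (univ : Set X)) (d := 1)
        (by rw [← hD]; exact_mod_cast h1)
      simpa using this
    filter_upwards [ae_hausdorffMeasure_levelSet_eq_zero hf le_rfl h0] with r hr
    left
    by_contra hne
    rw [sub_self] at hr
    have := one_le_hausdorffMeasure_zero_of_nonempty (nonempty_iff_ne_empty.2 hne)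
    rw [hr] at this
    simp at this
  · have h0 : ∀ k : ℕ, ∀ᵐ r : ℝ,
        μH[((D - 1 + (k + 1 : NNReal)⁻¹ : NNReal) : ℝ)] (f ⁻¹' {r}) = 0 := by
      intro k
      have hk : (0 : NNReal) < (k + 1 : NNReal)⁻¹ := by positivity
      have := hausdorffMeasure_of_dimH_lt (s := (univ : Set X)) (d := D + (k + 1 : NNReal)⁻¹)
        (by rw [← hD]; exact_mod_cast lt_add_of_pos_right D hk)
      have h2 := ae_hausdorffMeasure_levelSet_eq_zero hf ?_ this
      · convert h2 using 5
        push_cast [NNReal.coe_sub h1]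
        ring
      · exact_mod_cast h1.trans (le_add_of_nonneg_right hk.le)
    filter_upwards [ae_all_iff.2 h0] with r hr
    right
    have h3 : ∀ k : ℕ, dimH (f ⁻¹' {r}) ≤ ((D - 1 : NNReal) : ℝ≥0∞) + ((k : ℝ≥0∞) + 1)⁻¹ := by
      intro k
      have := dimH_le_of_hausdorffMeasure_ne_top (s := f ⁻¹' {r})
        (d := D - 1 + (k + 1 : NNReal)⁻¹) (by rw [hr k]; simp)
      refine this.trans_eq ?_
      rw [ENNReal.coe_add, ENNReal.coe_inv (by positivity)]
      simp
    have h4 : dimH (f ⁻¹' {r}) ≤ ((D - 1 : NNReal) : ℝ≥0∞) := by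
      have hlim : Tendsto (fun k : ℕ => ((D - 1 : NNReal) : ℝ≥0∞) + ((k : ℝ≥0∞) + 1)⁻¹) atTop
          (𝓝 (((D - 1 : NNReal) : ℝ≥0∞) + 0)) := by
        refine tendsto_const_nhds.add ?_
        have := (ENNReal.tendsto_inv_nat_nhds_zero).comp (tendsto_add_atTop_nat 1)
        simpa [Function.comp_def] using this
      rw [add_zero] at hlim
      exact ge_of_tendsto' hlim h3
    refine (add_le_add_left h4 1).trans_eq ?_
    rw [← ENNReal.coe_one, ← ENNReal.coe_add, tsub_add_cancel_of_le h1]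

end LevelSets

/-! ### Inequalities between the three dimensions -/

section Dimensions

lemma coe_ennreal_natCast (n : ℕ) : ((n : ℝ≥0∞) : EReal) = n := by
  rw [← ENNReal.coe_natCast, EReal.coe_nnreal_eq_coe_real, NNReal.coe_natCast, EReal.coe_natCast]

lemma ereal_neg_one_add_one : (-1 : EReal) + 1 = 0 := by
  rw [show (-1 : EReal) = ((-1 : ℝ) : EReal) by simp, ← EReal.coe_one, ← EReal.coe_add]
  simp

lemma hausDimSet_empty {X : Type*} [MetricSpace X] : hausDimSet (∅ : Set X) = -1 := if_pos rfl

lemma Set.Nonempty.hausDimSet_eq {X : Type*} [MetricSpace X] {A : Set X} (h : A.Nonempty) :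
    hausDimSet A = (dimH A : EReal) := if_neg h.ne_empty

lemma neg_one_le_coe_ennreal (x : ℝ≥0∞) : (-1 : EReal) ≤ x :=
  le_trans (by norm_num [EReal.neg_le]) (EReal.coe_ennreal_nonneg x)

lemma hausDimSet_mono {X : Type*} [MetricSpace X] {A B : Set X} (h : A ⊆ B) :
    hausDimSet A ≤ hausDimSet B := by
  rcases A.eq_empty_or_nonempty with rfl | hA
  · rw [hausDimSet_empty]
    rcases B.eq_empty_or_nonempty with rfl | hB
    · rw [hausDimSet_empty]
    · rw [hB.hausDimSet_eq]
      exact neg_one_le_coe_ennreal _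
  · rw [hA.hausDimSet_eq, (hA.mono h).hausDimSet_eq]
    exact EReal.coe_ennreal_le_coe_ennreal_iff.2 (dimH_mono h)

lemma neg_one_le_hausDimSet {X : Type*} [MetricSpace X] (A : Set X) : -1 ≤ hausDimSet A :=
  hausDimSet_empty (X := X) ▸ hausDimSet_mono (empty_subset A)

lemma Isometry.hausDimSet_image {X Y : Type*} [MetricSpace X] [MetricSpace Y] {f : X → Y}
    (hf : Isometry f) (A : Set X) : hausDimSet (f '' A) = hausDimSet A := by
  rcases A.eq_empty_or_nonempty with rfl | hA
  · simp [hausDimSet_empty]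
  · rw [hA.hausDimSet_eq, (hA.image f).hausDimSet_eq, hf.dimH_image]

lemma hausDim_coe_set {X : Type*} [MetricSpace X] (A : Set X) : hausDim A = hausDimSet A := by
  rw [hausDim, ← isometry_subtype_coe.hausDimSet_image, image_univ, Subtype.range_coe]

lemma hausDim_eq_dimH (X : Type*) [MetricSpace X] [Nonempty X] :
    hausDim X = (dimH (univ : Set X) : EReal) := univ_nonempty.hausDimSet_eq

lemma hausDim_of_isEmpty (X : Type*) [MetricSpace X] [IsEmpty X] : hausDim X = -1 := by
  rw [hausDim, univ_eq_empty_iff.2 ‹_›, hausDimSet_empty]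

/-- The space has a basis of open sets whose boundaries have Hausdorff dimension at most `c`. -/
def HasThinBasis (X : Type*) [MetricSpace X] (c : EReal) : Prop :=
  ∃ B : Set (Set X), IsTopologicalBasis B ∧ ∀ U ∈ B, hausDimSet (frontier U) ≤ c

lemma hasThinBasis_iff {X : Type*} [MetricSpace X] {c : EReal} :
    HasThinBasis X c ↔ ∀ x : X, ∀ U, IsOpen U → x ∈ U →
      ∃ V, IsOpen V ∧ x ∈ V ∧ V ⊆ U ∧ hausDimSet (frontier V) ≤ c := by
  constructor
  · rintro ⟨B, hB, hBc⟩ x U hU hx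
    obtain ⟨V, hV, hxV, hVU⟩ := hB.exists_subset_of_mem_open hx hU
    exact ⟨V, hB.isOpen hV, hxV, hVU, hBc V hV⟩
  · intro h
    refine ⟨{V | IsOpen V ∧ hausDimSet (frontier V) ≤ c},
      isTopologicalBasis_of_isOpen_of_nhds (fun V hV => hV.1) fun x U hx hU => ?_, fun V hV => hV.2⟩
    obtain ⟨V, hV, hxV, hVU, hc⟩ := h x U hU hx
    exact ⟨V, ⟨hV, hc⟩, hxV, hVU⟩

lemma topHausDim_of_isEmpty (X : Type*) [MetricSpace X] [h : IsEmpty X] : topHausDim X = -1 :=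
  if_pos h

lemma topHausDim_eq (X : Type*) [MetricSpace X] [Nonempty X] :
    topHausDim X = sInf {d : EReal | HasThinBasis X (d - 1)} := if_neg (not_isEmpty_iff.2 ‹_›)

lemma topHausDim_le {X : Type*} [MetricSpace X] [Nonempty X] {d : EReal}
    (h : HasThinBasis X (d - 1)) : topHausDim X ≤ d := by
  rw [topHausDim_eq]
  exact sInf_le h

lemma le_topHausDim {X : Type*} [MetricSpace X] [Nonempty X] {s : EReal}
    (h : ∀ d, HasThinBasis X (d - 1) → s ≤ d) : s ≤ topHausDim X := by
  rw [topHausDim_eq]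
  exact le_sInf h

lemma ereal_le_sub_one_iff {a b : EReal} : a ≤ b - 1 ↔ a + 1 ≤ b :=
  EReal.le_sub_iff_add_le (.inl (EReal.coe_ne_bot 1)) (.inl (EReal.coe_ne_top 1))

lemma HasThinBasis.nonneg {X : Type*} [MetricSpace X] [Nonempty X] {d : EReal}
    (h : HasThinBasis X (d - 1)) : 0 ≤ d := by
  obtain ⟨V, -, -, -, hV⟩ := hasThinBasis_iff.1 h (Classical.arbitrary X) univ isOpen_univ trivial
  have h1 := ereal_le_sub_one_iff.1 ((neg_one_le_hausDimSet _).trans hV)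
  rwa [ereal_neg_one_add_one] at h1

lemma topHausDim_nonneg (X : Type*) [MetricSpace X] [Nonempty X] : 0 ≤ topHausDim X :=
  le_topHausDim fun _ h => h.nonneg

/-- Almost all balls around a given point have a boundary of codimension one or more. -/
lemma hasThinBasis_hausDim_sub_one (X : Type*) [MetricSpace X] :
    HasThinBasis X (hausDim X - 1) := by
  refine hasThinBasis_iff.2 fun x U hU hx => ?_
  have : Nonempty X := ⟨x⟩
  obtain ⟨ε, hε, hεU⟩ := Metric.isOpen_iff.1 hU x hx
  have hlip : LipschitzWith 1 fun y : X => dist y x := LipschitzWith.dist_left x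
  have hne : (MeasureTheory.ae (MeasureTheory.volume.restrict (Ioo (0 : ℝ) ε))).NeBot := by
    rw [MeasureTheory.ae_neBot, Ne, MeasureTheory.Measure.restrict_eq_zero]
    simp [hε]
  obtain ⟨r, hr, hr0, hrε⟩ := ((MeasureTheory.ae_restrict_of_ae (s := Ioo 0 ε)
    (ae_dimH_levelSet hlip)).and
    (MeasureTheory.ae_restrict_mem measurableSet_Ioo)).exists
  refine ⟨Metric.ball x r, Metric.isOpen_ball, Metric.mem_ball_self hr0,
    (Metric.ball_subset_ball hrε.le).trans hεU, ?_⟩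
  have hsub : frontier (Metric.ball x r) ⊆ (fun y => dist y x) ⁻¹' {r} :=
    Metric.frontier_ball_subset_sphere
  refine (hausDimSet_mono hsub).trans ?_
  rw [ereal_le_sub_one_iff, hausDim_eq_dimH]
  rcases ((fun y => dist y x) ⁻¹' {r}).eq_empty_or_nonempty with he | hne
  · rw [he, hausDimSet_empty, ereal_neg_one_add_one]
    exact EReal.coe_ennreal_nonneg _
  · rw [hne.hausDimSet_eq]
    exact_mod_cast hr.resolve_left hne.ne_empty

lemma topHausDim_le_hausDim (X : Type*) [MetricSpace X] : topHausDim X ≤ hausDim X := by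
  rcases isEmpty_or_nonempty X with h | h
  · rw [topHausDim_of_isEmpty, hausDim_of_isEmpty]
  · exact topHausDim_le (hasThinBasis_hausDim_sub_one X)

lemma hasSmallInductiveDimensionLT_succ_iff {X : Type*} [TopologicalSpace X] {n : ℕ} :
    HasSmallInductiveDimensionLT X (n + 1) ↔ ∀ x : X, ∀ U, IsOpen U → x ∈ U →
      ∃ V, IsOpen V ∧ x ∈ V ∧ V ⊆ U ∧ HasSmallInductiveDimensionLT (frontier V) n := by
  constructor
  · rintro (_ | ⟨_, s, hs, h⟩) x U hU hx
    obtain ⟨V, hV, hxV, hVU⟩ := hs.exists_subset_of_mem_open hx hU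
    exact ⟨V, hs.isOpen hV, hxV, hVU, h V hV⟩
  · intro h
    refine .succ n {V | IsOpen V ∧ HasSmallInductiveDimensionLT (frontier V) n}
      (isTopologicalBasis_of_isOpen_of_nhds (fun V hV => hV.1) fun x U hx hU => ?_) fun V hV => hV.2
    obtain ⟨V, hV, hxV, hVU, hc⟩ := h x U hU hx
    exact ⟨V, ⟨hV, hc⟩, hxV, hVU⟩

/-- Szpilrajn's inequality between the topological and the Hausdorff dimension. -/
lemma hasSmallInductiveDimensionLT_of_hausDim_lt {X : Type*} [MetricSpace X] {n : ℕ}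
    (h : hausDim X < n) : HasSmallInductiveDimensionLT X n := by
  induction n generalizing X with
  | zero =>
    rw [hasSmallInductiveDimensionLT_zero_iff]
    by_contra hne
    rw [not_isEmpty_iff] at hne
    rw [hausDim_eq_dimH] at h
    exact absurd h (not_lt.2 (by simpa using EReal.coe_ennreal_nonneg _))
  | succ n ih =>
    refine hasSmallInductiveDimensionLT_succ_iff.2 fun x U hU hx => ?_
    obtain ⟨V, hV, hxV, hVU, hc⟩ := hasThinBasis_iff.1 (hasThinBasis_hausDim_sub_one X) x U hU hx
    refine ⟨V, hV, hxV, hVU, ih ?_⟩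
    rw [hausDim_coe_set]
    refine hc.trans_lt ?_
    refine (EReal.sub_lt_iff (.inl (EReal.coe_ne_bot 1)) (.inl (EReal.coe_ne_top 1))).2 ?_
    exact_mod_cast h

/-- For `n = 0` both sides say that `X` is empty. -/
lemma topDim_lt_natCast_iff {X : Type*} [TopologicalSpace X] {n : ℕ} :
    topDim X < n ↔ HasSmallInductiveDimensionLT X n := by
  rw [← smallInductiveDimension_lt_iff, topDim]
  induction smallInductiveDimension X with
  | bot =>
    simp only [WithBot.map_bot, WithBot.unbotD_bot]
    refine iff_of_true ?_ (WithBot.bot_lt_coe (n : ℕ∞))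
    exact lt_of_lt_of_le (by simp) (b := (0 : EReal)) (by exact_mod_cast n.zero_le)
  | coe m =>
    simp only [WithBot.map_coe, WithBot.unbotD_coe]
    rw [← coe_ennreal_natCast, EReal.coe_ennreal_lt_coe_ennreal_iff,
      ← ENat.toENNReal_coe, ENat.toENNReal_lt]
    exact WithBot.coe_lt_coe.symm

lemma topDim_of_isEmpty (X : Type*) [TopologicalSpace X] [IsEmpty X] : topDim X = -1 := by
  simp [topDim]

lemma topDim_eq_top_or_natCast (X : Type*) [TopologicalSpace X] [Nonempty X] :
    topDim X = ⊤ ∨ ∃ n : ℕ, topDim X = n := by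
  have h : smallInductiveDimension X ≠ ⊥ := by simp
  rw [topDim]
  induction hs : smallInductiveDimension X with
  | bot => exact absurd hs h
  | coe m =>
    induction m with
    | top => left; change ((((⊤ : ℕ∞) : ℝ≥0∞)) : EReal) = ⊤; simp
    | coe m => right; exact ⟨m, coe_ennreal_natCast m⟩

/-- The topological dimension is at most the topological Hausdorff dimension. -/
lemma topDim_le_topHausDim (X : Type*) [MetricSpace X] : topDim X ≤ topHausDim X := by
  rcases isEmpty_or_nonempty X with h | h
  · rw [topHausDim_of_isEmpty, topDim_of_isEmpty]
  refine le_topHausDim fun d hd => ?_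
  have hd0 := hd.nonneg
  induction d with
  | bot => simp at hd0
  | top => exact le_top
  | coe d =>
    have hd0 : 0 ≤ d := by exact_mod_cast hd0
    -- Boundaries of dimension at most `d - 1` have topological dimension less than `⌊d⌋`.
    have hlt : HasSmallInductiveDimensionLT X (⌊d⌋₊ + 1) := by
      refine hasSmallInductiveDimensionLT_succ_iff.2 fun x U hU hx => ?_
      obtain ⟨V, hV, hxV, hVU, hc⟩ := hasThinBasis_iff.1 hd x U hU hx
      refine ⟨V, hV, hxV, hVU, hasSmallInductiveDimensionLT_of_hausDim_lt ?_⟩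
      rw [hausDim_coe_set]
      refine hc.trans_lt ?_
      have := Nat.lt_floor_add_one d
      have h2 : d - 1 < (⌊d⌋₊ : ℝ) := by linarith
      exact_mod_cast h2
    rw [← topDim_lt_natCast_iff] at hlt
    have hle : topDim X ≤ (⌊d⌋₊ : ℕ) := by
      rcases topDim_eq_top_or_natCast X with h | ⟨n, h⟩
      · rw [h] at hlt
        exact absurd hlt not_top_lt
      · rw [h] at hlt ⊢
        exact_mod_cast Nat.lt_succ_iff.1 (by exact_mod_cast hlt)
    refine hle.trans ?_
    have := Nat.floor_le hd0
    exact_mod_cast this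

/-- Clopen sets have an empty boundary, whose Hausdorff dimension is `-1`. -/
lemma hasThinBasis_of_zeroDim {X : Type*} [MetricSpace X] (h : HasSmallInductiveDimensionLT X 1) :
    HasThinBasis X (-1) := by
  rw [hasSmallInductiveDimensionLT_one_iff] at h
  exact ⟨_, h, fun U hU => by rw [hU.frontier_eq, hausDimSet_empty]⟩

lemma HasThinBasis.mono {X : Type*} [MetricSpace X] {c c' : EReal} (h : HasThinBasis X c)
    (hc : c ≤ c') : HasThinBasis X c' :=
  let ⟨B, hB, hBc⟩ := h
  ⟨B, hB, fun U hU => (hBc U hU).trans hc⟩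

lemma topHausDim_eq_zero_of_topDim_eq_zero {X : Type*} [MetricSpace X] [Nonempty X]
    (h : topDim X = 0) : topHausDim X = 0 := by
  refine le_antisymm (topHausDim_le ?_) (topHausDim_nonneg X)
  have h1 : HasSmallInductiveDimensionLT X 1 := by
    rw [← topDim_lt_natCast_iff, h]
    simp
  simpa using hasThinBasis_of_zeroDim h1

end Dimensions

/-! ### Subspaces, disjoint unions and products with an interval -/

section Transfer

variable {X Y : Type*} [MetricSpace X] [MetricSpace Y]

lemma topDim_le_natCast_iff {X : Type*} [TopologicalSpace X] {n : ℕ} :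
    topDim X ≤ n ↔ HasSmallInductiveDimensionLT X (n + 1) := by
  rw [← topDim_lt_natCast_iff]
  rcases isEmpty_or_nonempty X with h | h
  · have h1 : ∀ m : ℕ, topDim X < m := fun m => topDim_lt_natCast_iff.2 inferInstance
    exact iff_of_true (h1 n).le (h1 _)
  · rcases topDim_eq_top_or_natCast X with h | ⟨m, h⟩
    · rw [h]
      exact iff_of_false (by simpa using EReal.natCast_ne_top n) not_top_lt
    · rw [h, EReal.natCast_le_iff, EReal.natCast_lt_iff, Nat.lt_succ_iff]

lemma Topology.IsInducing.topDim_le {X Y : Type*} [TopologicalSpace X] [TopologicalSpace Y]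
    {f : X → Y} (hf : IsInducing f) : topDim X ≤ topDim Y := by
  rcases isEmpty_or_nonempty Y with h | h
  · have := Function.isEmpty f
    rw [topDim_of_isEmpty, topDim_of_isEmpty]
  · rcases topDim_eq_top_or_natCast Y with h | ⟨m, h⟩
    · exact h ▸ le_top
    · rw [h, topDim_le_natCast_iff]
      exact hf.hasSmallInductiveDimensionLT (topDim_le_natCast_iff.1 h.le)

lemma Isometry.hausDim_le {f : X → Y} (hf : Isometry f) : hausDim X ≤ hausDim Y := by
  rw [hausDim, ← hf.hausDimSet_image]
  exact hausDimSet_mono (subset_univ _)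

lemma Isometry.hasThinBasis {f : X → Y} (hf : Isometry f) {c : EReal} (h : HasThinBasis Y c) :
    HasThinBasis X c := by
  obtain ⟨B, hB, hBc⟩ := h
  refine ⟨_, hB.isInducing hf.isEmbedding.isInducing, ?_⟩
  rintro _ ⟨U, hU, rfl⟩
  rw [← hf.hausDimSet_image]
  refine (hausDimSet_mono ?_).trans (hBc U hU)
  exact image_subset_iff.2 (hf.continuous.frontier_preimage_subset U)

lemma Isometry.topHausDim_le [Nonempty X] {f : X → Y} (hf : Isometry f) :
    topHausDim X ≤ topHausDim Y := by
  have : Nonempty Y := .map f ‹_›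
  exact le_topHausDim fun d hd => _root_.topHausDim_le (hf.hasThinBasis hd)

/-- The images of small sets under the inclusion of a clopen part have the same boundary. -/
lemma frontier_image_of_isClopen_range {X Y : Type*} [TopologicalSpace X] [TopologicalSpace Y]
    {f : X → Y} (hf : IsEmbedding f) (hr : IsClopen (range f)) {V : Set X} (hV : IsOpen V) :
    IsOpen (f '' V) ∧ frontier (f '' V) = f '' frontier V := by
  have ho : IsOpenEmbedding f := ⟨hf, hr.isOpen⟩
  have hc : IsClosedEmbedding f := ⟨hf, hr.isClosed⟩
  have hfV := ho.isOpenMap V hV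
  refine ⟨hfV, ?_⟩
  rw [hfV.frontier_eq, hV.frontier_eq, hc.closure_image_eq, image_sdiff hf.injective]

variable {K : Type*} [MetricSpace K]

lemma HasThinBasis.union {f : X → K} {g : Y → K} (hf : Isometry f) (hg : Isometry g)
    (hfr : IsClopen (range f)) (hgr : IsClopen (range g)) (hfg : range f ∪ range g = univ)
    {c : EReal} (hX : HasThinBasis X c) (hY : HasThinBasis Y c) : HasThinBasis K c := by
  refine hasThinBasis_iff.2 fun z U hU hz => ?_
  rcases (hfg ▸ mem_univ z : z ∈ range f ∪ range g) with ⟨x, rfl⟩ | ⟨x, rfl⟩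
  · obtain ⟨V, hV, hxV, hVU, hc⟩ :=
      hasThinBasis_iff.1 hX x _ (hU.preimage hf.continuous) hz
    obtain ⟨h1, h2⟩ := frontier_image_of_isClopen_range hf.isEmbedding hfr hV
    exact ⟨f '' V, h1, ⟨x, hxV, rfl⟩, image_subset_iff.2 hVU, by rwa [h2, hf.hausDimSet_image]⟩
  · obtain ⟨V, hV, hxV, hVU, hc⟩ :=
      hasThinBasis_iff.1 hY x _ (hU.preimage hg.continuous) hz
    obtain ⟨h1, h2⟩ := frontier_image_of_isClopen_range hg.isEmbedding hgr hV
    exact ⟨g '' V, h1, ⟨x, hxV, rfl⟩, image_subset_iff.2 hVU, by rwa [h2, hg.hausDimSet_image]⟩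

lemma HasSmallInductiveDimensionLT.union {X Y K : Type*} [TopologicalSpace X] [TopologicalSpace Y]
    [TopologicalSpace K] {f : X → K} {g : Y → K} (hf : IsEmbedding f) (hg : IsEmbedding g)
    (hfr : IsClopen (range f)) (hgr : IsClopen (range g)) (hfg : range f ∪ range g = univ)
    {n : ℕ} (hX : HasSmallInductiveDimensionLT X (n + 1))
    (hY : HasSmallInductiveDimensionLT Y (n + 1)) : HasSmallInductiveDimensionLT K (n + 1) := by
  refine hasSmallInductiveDimensionLT_succ_iff.2 fun z U hU hz => ?_
  rcases (hfg ▸ mem_univ z : z ∈ range f ∪ range g) with ⟨x, rfl⟩ | ⟨x, rfl⟩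
  · obtain ⟨V, hV, hxV, hVU, hc⟩ :=
      hasSmallInductiveDimensionLT_succ_iff.1 hX x _ (hU.preimage hf.continuous) hz
    obtain ⟨h1, h2⟩ := frontier_image_of_isClopen_range hf hfr hV
    refine ⟨f '' V, h1, ⟨x, hxV, rfl⟩, image_subset_iff.2 hVU, ?_⟩
    rw [h2]
    exact (hf.homeomorphImage _).symm.isInducing.hasSmallInductiveDimensionLT hc
  · obtain ⟨V, hV, hxV, hVU, hc⟩ :=
      hasSmallInductiveDimensionLT_succ_iff.1 hY x _ (hU.preimage hg.continuous) hz
    obtain ⟨h1, h2⟩ := frontier_image_of_isClopen_range hg hgr hV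
    refine ⟨g '' V, h1, ⟨x, hxV, rfl⟩, image_subset_iff.2 hVU, ?_⟩
    rw [h2]
    exact (hg.homeomorphImage _).symm.isInducing.hasSmallInductiveDimensionLT hc

/-- Two compact metric spaces are complementary clopen parts of a third one. -/
lemma exists_compact_union {X Y : Type} [MetricSpace X] [MetricSpace Y] [CompactSpace X]
    [CompactSpace Y] :
    ∃ (K : Type) (_ : MetricSpace K) (f : X → K) (g : Y → K), CompactSpace K ∧ Isometry f ∧
      Isometry g ∧ IsClopen (range f) ∧ IsClopen (range g) ∧ range f ∪ range g = univ :=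
  letI := Metric.metricSpaceSum (X := X) (Y := Y)
  ⟨X ⊕ Y, inferInstance, Sum.inl, Sum.inr, inferInstanceAs (CompactSpace (X ⊕ Y)),
    Metric.isometry_inl, Metric.isometry_inr, isClopen_range_inl, isClopen_range_inr,
    range_inl_union_range_inr⟩

end Transfer

section Product

lemma zeroDim_prod {X Y : Type*} [TopologicalSpace X] [TopologicalSpace Y]
    (hX : HasSmallInductiveDimensionLT X 1) (hY : HasSmallInductiveDimensionLT Y 1) :
    HasSmallInductiveDimensionLT (X × Y) 1 := by
  rw [hasSmallInductiveDimensionLT_one_iff_forall_isOpen] at *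
  rintro U hU ⟨x, y⟩ hxy
  obtain ⟨A, B, hA, hB, hxA, hyB, hAB⟩ := isOpen_prod_iff.1 hU x y hxy
  obtain ⟨A', hA', hxA', hAA⟩ := hX A hA x hxA
  obtain ⟨B', hB', hyB', hBB⟩ := hY B hB y hyB
  exact ⟨A' ×ˢ B', hA'.prod hB', ⟨hxA', hyB'⟩, (prod_mono hAA hBB).trans hAB⟩

lemma dimH_unitInterval : dimH (univ : Set unitInterval) = 1 := by
  rw [← isometry_subtype_coe.dimH_image, image_univ, Subtype.range_coe]
  have : (interior (Icc (0 : ℝ) 1)).Nonempty := by rw [interior_Icc]; simp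
  simpa using Real.dimH_of_nonempty_interior this

lemma hasSmallInductiveDimensionLT_prod_unitInterval {X : Type*} [TopologicalSpace X]
    (hX : HasSmallInductiveDimensionLT X 1) :
    HasSmallInductiveDimensionLT (X × unitInterval) 2 := by
  have hI : HasSmallInductiveDimensionLT unitInterval 2 := by
    apply hasSmallInductiveDimensionLT_of_hausDim_lt
    rw [hausDim_eq_dimH, dimH_unitInterval]
    have h : ((1 : ℕ) : EReal) < ((2 : ℕ) : EReal) := EReal.natCast_lt_iff.2 one_lt_two
    rwa [Nat.cast_one] at h
  refine hasSmallInductiveDimensionLT_succ_iff.2 ?_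
  rintro ⟨x, y⟩ U hU hxy
  obtain ⟨A, B, hA, hB, hxA, hyB, hAB⟩ := isOpen_prod_iff.1 hU x y hxy
  obtain ⟨A', hA', hxA', hAA⟩ :=
    hasSmallInductiveDimensionLT_one_iff_forall_isOpen.1 hX A hA x hxA
  obtain ⟨B', hB', hyB', hBB, hd⟩ := hasSmallInductiveDimensionLT_succ_iff.1 hI y B hB hyB
  refine ⟨A' ×ˢ B', hA'.isOpen.prod hB', ⟨hxA', hyB'⟩, (prod_mono hAA hBB).trans hAB, ?_⟩
  have hfr : ∀ p : frontier (A' ×ˢ B'), p.1.2 ∈ frontier B' := by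
    rintro ⟨p, hp⟩
    rw [frontier_prod_eq, hA'.frontier_eq, empty_prod, union_empty] at hp
    exact hp.2
  have hval : IsInducing fun p : frontier (A' ×ˢ B') => (p : X × unitInterval) :=
    IsInducing.subtypeVal
  refine IsInducing.hasSmallInductiveDimensionLT (Y := X × frontier B')
    (f := fun p => (p.1.1, ⟨p.1.2, hfr p⟩)) ?_ (zeroDim_prod hX hd)
  exact .of_comp (g := fun q : X × frontier B' => (q.1, (q.2 : unitInterval))) (by fun_prop)
    (by fun_prop) hval

/-- The boundary of a small neighbourhood in `X × [0, 1]` projects onto an open subset of `X`. -/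
lemma le_topHausDim_prod_unitInterval {X : Type*} [MetricSpace X] [Nonempty X] {u : ℝ≥0∞}
    (hu : ∀ W : Set X, IsOpen W → W.Nonempty → u ≤ dimH W) :
    (u : EReal) + 1 ≤ topHausDim (X × unitInterval) := by
  refine le_topHausDim fun d hd => ?_
  obtain ⟨x⟩ := ‹Nonempty X›
  set h : unitInterval := ⟨1 / 2, by norm_num, by norm_num⟩ with hh
  have hU : IsOpen {p : X × unitInterval | p.2 ≠ 0} :=
    isOpen_ne_fun continuous_snd continuous_const
  have hh0 : h ≠ 0 := fun h0 => by
    have := congrArg Subtype.val h0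
    norm_num [hh] at this
  obtain ⟨V, hV, hxV, hVU, hc⟩ := hasThinBasis_iff.1 hd (x, h) _ hU hh0
  set W : Set X := {c | (c, h) ∈ V} with hW
  have hWo : IsOpen W := hV.preimage (by fun_prop)
  have hWsub : W ⊆ Prod.fst '' frontier V := by
    intro c hcW
    have hcont : Continuous fun y : unitInterval => (c, y) := by fun_prop
    have hne : (fun y : unitInterval => (c, y)) ⁻¹' V ≠ univ := fun h0 =>
      hVU (h0 ▸ mem_univ (0 : unitInterval) :
        (0 : unitInterval) ∈ (fun y : unitInterval => (c, y)) ⁻¹' V) rfl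
    obtain ⟨y, hy⟩ := nonempty_frontier_iff.2 ⟨⟨h, hcW⟩, hne⟩
    exact ⟨_, hcont.frontier_preimage_subset V hy, rfl⟩
  have hWne : W.Nonempty := ⟨x, hxV⟩
  have hfr : (frontier V).Nonempty := (hWne.mono hWsub).of_image
  rw [← ereal_le_sub_one_iff]
  refine le_trans ?_ hc
  rw [hfr.hausDimSet_eq, EReal.coe_ennreal_le_coe_ennreal_iff]
  calc u ≤ dimH W := hu W hWo hWne
    _ ≤ dimH (Prod.fst '' frontier V) := dimH_mono hWsub
    _ ≤ dimH (frontier V) := LipschitzWith.prod_fst.dimH_image_le _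

end Product

/-! ### Cantor spaces of prescribed Hausdorff dimension -/

section CantorSpace

/-- A sequence of positive reals that decreases to zero, used as the diameters of the cylinders of
a Cantor space. -/
structure CylinderScale where
  /-- The diameter of the cylinders of length `k`. -/
  r : ℕ → ℝ
  pos : ∀ k, 0 < r k
  anti : Antitone r
  tendsto : Filter.Tendsto r Filter.atTop (𝓝 0)

/-- The space of binary sequences with the ultrametric whose value at `x ≠ y` is `ρ.r k`, where `k`
is the first index with `x k ≠ y k`. -/
def CantorSpace (_ : CylinderScale) : Type := ℕ → Fin 2

variable {ρ : CylinderScale}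

open Classical in
/-- The distance of `CantorSpace`. -/
noncomputable def cantorDist (ρ : CylinderScale) (x y : ℕ → Fin 2) : ℝ :=
  if x = y then 0 else ρ.r (PiNat.firstDiff x y)

lemma cantorDist_of_ne {x y : ℕ → Fin 2} (h : x ≠ y) :
    cantorDist ρ x y = ρ.r (PiNat.firstDiff x y) := if_neg h

lemma cantorDist_self (x : ℕ → Fin 2) : cantorDist ρ x x = 0 := if_pos rfl

lemma cantorDist_comm (x y : ℕ → Fin 2) : cantorDist ρ x y = cantorDist ρ y x := by
  rcases eq_or_ne x y with rfl | h
  · rfl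
  · rw [cantorDist_of_ne h, cantorDist_of_ne h.symm, PiNat.firstDiff_comm]

lemma cantorDist_nonneg (x y : ℕ → Fin 2) : 0 ≤ cantorDist ρ x y := by
  rw [cantorDist]
  split_ifs
  · exact le_rfl
  · exact (ρ.pos _).le

lemma cantorDist_le_max (x y z : ℕ → Fin 2) :
    cantorDist ρ x z ≤ max (cantorDist ρ x y) (cantorDist ρ y z) := by
  by_cases hxz : x = z
  · rw [hxz, cantorDist_self]
    exact le_max_of_le_left (cantorDist_nonneg _ _)
  by_cases hxy : x = y
  · rw [hxy]; exact le_max_right _ _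
  by_cases hyz : y = z
  · rw [hyz]; exact le_max_left _ _
  rw [cantorDist_of_ne hxz, cantorDist_of_ne hxy, cantorDist_of_ne hyz, ← ρ.anti.map_min]
  exact ρ.anti (PiNat.min_firstDiff_le x y z hxz)

noncomputable instance : MetricSpace (CantorSpace ρ) where
  dist := cantorDist ρ
  dist_self := cantorDist_self
  dist_comm := cantorDist_comm
  dist_triangle x y z := (cantorDist_le_max x y z).trans
    (max_le_add_of_nonneg (cantorDist_nonneg _ _) (cantorDist_nonneg _ _))
  eq_of_dist_eq_zero {x y} h := by
    by_contra hne
    exact (ρ.pos _).ne' ((cantorDist_of_ne hne).symm.trans h)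

instance : IsUltrametricDist (CantorSpace ρ) := ⟨cantorDist_le_max⟩

instance : Nonempty (CantorSpace ρ) := ⟨fun _ => 0⟩

lemma CantorSpace.dist_of_ne {x y : CantorSpace ρ} (h : x ≠ y) :
    dist x y = ρ.r (PiNat.firstDiff (E := fun _ => Fin 2) x y) := cantorDist_of_ne h

/-- Sequences with equal first `k` entries have distance at most `ρ.r k`. -/
lemma CantorSpace.dist_le {x y : CantorSpace ρ} {k : ℕ} (h : ∀ i < k, x i = y i) :
    dist x y ≤ ρ.r k := by
  by_cases hxy : x = y
  · rw [hxy, dist_self]; exact (ρ.pos k).le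
  · rw [CantorSpace.dist_of_ne hxy]
    refine ρ.anti ?_
    by_contra! hlt
    exact PiNat.apply_firstDiff_ne hxy (h _ hlt)

instance : CompactSpace (CantorSpace ρ) := by
  let e : (ℕ → Fin 2) → CantorSpace ρ := id
  have he : Continuous e := by
    rw [continuous_iff_continuousAt]
    intro x
    rw [ContinuousAt, Metric.tendsto_nhds]
    intro ε hε
    obtain ⟨k, hk⟩ := (ρ.tendsto.eventually (gt_mem_nhds hε)).exists
    filter_upwards [(PiNat.isOpen_cylinder (fun _ => Fin 2) x k).mem_nhds
      (PiNat.self_mem_cylinder x k)] with y hy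
    exact (CantorSpace.dist_le fun i hi => PiNat.mem_cylinder_iff.1 hy i hi).trans_lt hk
  exact Function.Surjective.compactSpace (f := e) he Function.surjective_id

lemma CantorSpace.zeroDim : HasSmallInductiveDimensionLT (CantorSpace ρ) 1 := by
  rw [hasSmallInductiveDimensionLT_one_iff_forall_isOpen]
  intro U hU x hx
  obtain ⟨ε, hε, hεU⟩ := Metric.isOpen_iff.1 hU x hx
  exact ⟨Metric.ball x ε, IsUltrametricDist.isClopen_ball x ε, Metric.mem_ball_self hε, hεU⟩

/-- Reading the tail of a sequence as binary digits maps a cylinder onto `[0, 1]`, and this map is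
Hölder continuous. -/
lemma CantorSpace.le_dimH_of_isOpen {u : NNReal} (hu : 0 < u) {C : NNReal}
    (hC : ∀ m, ((2 : ℝ) ^ m)⁻¹ ≤ C * ρ.r m ^ (u : ℝ)) {W : Set (CantorSpace ρ)} (hW : IsOpen W)
    (hne : W.Nonempty) : (u : ℝ≥0∞) ≤ dimH W := by
  obtain ⟨c, hc⟩ := hne
  obtain ⟨ε, hε, hεW⟩ := Metric.isOpen_iff.1 hW c hc
  obtain ⟨k, hk⟩ := (ρ.tendsto.eventually (gt_mem_nhds hε)).exists
  let f : CantorSpace ρ → ℝ := fun x => Real.ofDigits fun n => x (n + k)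
  have hf : HolderWith (2 ^ k * C) u f := by
    intro x y
    by_cases hxy : x = y
    · simp [hxy]
    have h1 : dist (f x) (f y) ≤ 2 ^ k * C * dist x y ^ (u : ℝ) := by
      rw [CantorSpace.dist_of_ne hxy]
      set m := PiNat.firstDiff (E := fun _ => Fin 2) x y with hm
      have h2 : dist (f x) (f y) ≤ ((2 : ℝ) ^ (m - k))⁻¹ := by
        have := Real.abs_ofDigits_sub_ofDigits_le (b := 2) (x := fun n => x (n + k))
          (y := fun n => y (n + k)) (n := m - k) fun i hi =>
            PiNat.apply_eq_of_lt_firstDiff (E := fun _ => Fin 2) (by omega)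
        exact_mod_cast this
      refine h2.trans ?_
      calc ((2 : ℝ) ^ (m - k))⁻¹ ≤ 2 ^ k * ((2 : ℝ) ^ m)⁻¹ := by
            rw [← div_eq_mul_inv, inv_le_comm₀ (by positivity) (by positivity), inv_div,
              div_le_iff₀ (by positivity), ← pow_add]
            exact pow_le_pow_right₀ one_le_two (by omega)
        _ ≤ 2 ^ k * (C * ρ.r m ^ (u : ℝ)) := by gcongr; exact hC m
        _ = _ := by ring
    rw [edist_dist, edist_dist, ENNReal.ofReal_rpow_of_nonneg dist_nonneg u.coe_nonneg,
      ← ENNReal.ofReal_coe_nnreal, ← ENNReal.ofReal_mul (by positivity)]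
    exact ENNReal.ofReal_le_ofReal (by simpa using h1)
  have hsurj : Icc (0 : ℝ) 1 ⊆ f '' W := by
    intro y hy
    obtain ⟨d, -, rfl⟩ := Real.ofDigits_SurjOn (b := 2) one_lt_two hy
    let x : CantorSpace ρ := fun n => if n < k then c n else d (n - k)
    refine ⟨x, hεW ?_, ?_⟩
    · refine (CantorSpace.dist_le (k := k) fun i hi => ?_).trans_lt hk
      simp [x, hi]
    · simp [f, x]
  have h1 : dimH (Icc (0 : ℝ) 1) = 1 := by
    have := dimH_unitInterval
    rwa [← isometry_subtype_coe.dimH_image, image_univ, Subtype.range_coe] at this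
  have h2 : 1 ≤ dimH W / u := h1 ▸ (dimH_mono hsurj).trans (hf.dimH_image_le hu W)
  have hu0 : (u : ℝ≥0∞) ≠ 0 := by exact_mod_cast hu.ne'
  rwa [ENNReal.le_div_iff_mul_le (.inl hu0) (.inl ENNReal.coe_ne_top), one_mul] at h2

open MeasureTheory Measure Filter in
/-- Cylinders of length `k` times intervals of length `ρ.r k` form a covering of `C × [0, 1]` by
about `2 ^ k / ρ.r k` sets of diameter at most `ρ.r k`. -/
lemma CantorSpace.dimH_prod_unitInterval_le {u : NNReal} (h1 : ρ.r 0 ≤ 1)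
    (hρ : ∀ m, ρ.r m ^ (u : ℝ) = ((2 : ℝ) ^ m)⁻¹) :
    dimH (univ : Set (CantorSpace ρ × unitInterval)) ≤ u + 1 := by
  borelize (CantorSpace ρ × unitInterval)
  have hr1 : ∀ k, ρ.r k ≤ 1 := fun k => (ρ.anti k.zero_le).trans h1
  let N : ℕ → ℕ := fun k => ⌊(ρ.r k)⁻¹⌋₊ + 1
  let t : ∀ k, (Fin k → Fin 2) × Fin (N k) → Set (CantorSpace ρ × unitInterval) := fun k i =>
    {p | (∀ l : Fin k, p.1 l = i.1 l) ∧ (i.2 : ℝ) * ρ.r k ≤ p.2 ∧ (p.2 : ℝ) ≤ (i.2 + 1) * ρ.r k}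
  have hdiam : ∀ k i, Metric.ediam (t k i) ≤ ENNReal.ofReal (ρ.r k) := by
    intro k i
    refine Metric.ediam_le fun p hp q hq => ?_
    rw [edist_dist]
    refine ENNReal.ofReal_le_ofReal (max_le ?_ ?_)
    · refine CantorSpace.dist_le fun l hl => ?_
      rw [hp.1 ⟨l, hl⟩, hq.1 ⟨l, hl⟩]
    · rw [Subtype.dist_eq, Real.dist_eq, abs_le]
      have := hp.2; have := hq.2
      constructor <;> linarith
  have hcov : ∀ k, univ ⊆ ⋃ i, t k i := by
    rintro k ⟨x, y⟩ -
    have hpos := ρ.pos k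
    have hy0 : 0 ≤ (y : ℝ) / ρ.r k := div_nonneg y.2.1 hpos.le
    have hlt : ⌊(y : ℝ) / ρ.r k⌋₊ < N k := by
      refine Nat.lt_succ_of_le (Nat.floor_le_floor ?_)
      rw [div_eq_mul_inv]
      exact mul_le_of_le_one_left (inv_nonneg.2 hpos.le) y.2.2
    refine mem_iUnion.2 ⟨(fun l => x l, ⟨_, hlt⟩), fun l => rfl, ?_, ?_⟩
    · exact (le_div_iff₀ hpos).1 (Nat.floor_le hy0)
    · exact ((div_lt_iff₀ hpos).1 (Nat.lt_floor_add_one _)).le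
  have hsum : ∀ k, ∑ i, Metric.ediam (t k i) ^ ((u + 1 : NNReal) : ℝ) ≤ 2 := by
    intro k
    have hpos := ρ.pos k
    calc ∑ i, Metric.ediam (t k i) ^ ((u + 1 : NNReal) : ℝ)
        ≤ ∑ _i : (Fin k → Fin 2) × Fin (N k), ENNReal.ofReal (ρ.r k) ^ ((u + 1 : NNReal) : ℝ) :=
          Finset.sum_le_sum fun i _ => ENNReal.rpow_le_rpow (hdiam k i) (NNReal.coe_nonneg _)
      _ = ENNReal.ofReal (2 ^ k * N k * ρ.r k ^ ((u + 1 : NNReal) : ℝ)) := by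
          rw [ENNReal.ofReal_mul (by positivity), ENNReal.ofReal_rpow_of_pos hpos,
            ENNReal.ofReal_mul (by positivity)]
          simp [ENNReal.ofReal_pow]
      _ ≤ ENNReal.ofReal 2 := by
          refine ENNReal.ofReal_le_ofReal ?_
          have hN : (N k : ℝ) * ρ.r k ≤ 2 := by
            have := Nat.floor_le (inv_nonneg.2 hpos.le)
            have h2 := mul_le_mul_of_nonneg_right this hpos.le
            rw [inv_mul_cancel₀ hpos.ne'] at h2
            simp only [N]
            push_cast
            linarith [hr1 k]
          rw [NNReal.coe_add, NNReal.coe_one, Real.rpow_add hpos, Real.rpow_one, hρ]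
          calc (2 : ℝ) ^ k * N k * (((2 : ℝ) ^ k)⁻¹ * ρ.r k) = N k * ρ.r k := by
                field_simp
            _ ≤ 2 := hN
      _ = 2 := by simp
  have hfin : μH[((u + 1 : NNReal) : ℝ)] (univ : Set (CantorSpace ρ × unitInterval)) ≤ 2 := by
    refine (hausdorffMeasure_le_liminf_sum _ _ (l := atTop) (fun k => ENNReal.ofReal (ρ.r k)) ?_ t
      (.of_forall hdiam) (.of_forall hcov)).trans ?_
    · simpa using ENNReal.tendsto_ofReal ρ.tendsto
    · exact (liminf_le_liminf (.of_forall hsum)).trans_eq (by simp)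
  have := dimH_le_of_hausdorffMeasure_ne_top (ne_top_of_le_ne_top ENNReal.ofNat_ne_top hfin)
  simpa using this

/-- The dimension of the factor is recovered from a level set of the projection to `[0, 1]`. -/
lemma dimH_le_of_dimH_prod_unitInterval_le {X : Type*} [MetricSpace X] [Nonempty X] {u : ℝ≥0∞}
    (h : dimH (univ : Set (X × unitInterval)) ≤ u + 1) : dimH (univ : Set X) ≤ u := by
  have hlip : LipschitzWith 1 fun p : X × unitInterval => (p.2 : ℝ) := by
    have : LipschitzWith (1 * 1) fun p : X × unitInterval => (p.2 : ℝ) :=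
      (LipschitzWith.subtype_val unitInterval).comp LipschitzWith.prod_snd
    rwa [one_mul] at this
  have hne : (MeasureTheory.ae (MeasureTheory.volume.restrict (Ioo (0 : ℝ) 1))).NeBot := by
    rw [MeasureTheory.ae_neBot, Ne, MeasureTheory.Measure.restrict_eq_zero]
    simp
  obtain ⟨r, hr, hr0, hr1⟩ := ((MeasureTheory.ae_restrict_of_ae (s := Ioo (0 : ℝ) 1)
    (ae_dimH_levelSet hlip)).and (MeasureTheory.ae_restrict_mem measurableSet_Ioo)).exists
  let y : unitInterval := ⟨r, hr0.le, hr1.le⟩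
  have hiso : Isometry fun x : X => (x, y) := Isometry.of_dist_eq fun a b => by
    simp [Prod.dist_eq]
  have hsub : (fun x : X => (x, y)) '' univ ⊆ (fun p : X × unitInterval => (p.2 : ℝ)) ⁻¹' {r} := by
    rintro _ ⟨x, -, rfl⟩; rfl
  have hr' := hr.resolve_left (((univ_nonempty (α := X)).image _).mono hsub).ne_empty
  rw [← hiso.dimH_image]
  exact (dimH_mono hsub).trans ((ENNReal.add_le_add_iff_right ENNReal.one_ne_top).1 (hr'.trans h))

/-- The scale `2 ^ (-k / u)`, for which the Cantor space has dimension `u`. -/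
noncomputable def geometricScale (u : NNReal) (hu : 0 < u) : CylinderScale where
  r k := ((2 : ℝ) ^ (-(u : ℝ)⁻¹)) ^ k
  pos k := by positivity
  anti := pow_right_anti₀ (by positivity)
    (Real.rpow_le_one_of_one_le_of_nonpos one_le_two (by simp))
  tendsto := tendsto_pow_atTop_nhds_zero_of_lt_one (by positivity)
    (Real.rpow_lt_one_of_one_lt_of_neg one_lt_two (by simpa using hu))

lemma geometricScale_rpow (u : NNReal) (hu : 0 < u) (m : ℕ) :
    (geometricScale u hu).r m ^ (u : ℝ) = ((2 : ℝ) ^ m)⁻¹ := by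
  have hu' : (u : ℝ) ≠ 0 := by exact_mod_cast hu.ne'
  change (((2 : ℝ) ^ (-(u : ℝ)⁻¹)) ^ m) ^ (u : ℝ) = _
  rw [← Real.rpow_natCast, ← Real.rpow_mul two_pos.le, ← Real.rpow_mul two_pos.le,
    ← Real.rpow_natCast, ← Real.rpow_neg two_pos.le]
  congr 1
  field_simp

/-- The scale `1 / (k + 1)`, for which the Cantor space has infinite dimension. -/
noncomputable def harmonicScale : CylinderScale where
  r k := 1 / ((k : ℝ) + 1)
  pos k := by positivity
  anti _ _ h := one_div_le_one_div_of_le (by positivity) (by gcongr)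
  tendsto := tendsto_one_div_add_atTop_nhds_zero_nat

lemma exists_le_mul_harmonicScale_rpow (n : ℕ) :
    ∃ C : NNReal, ∀ m, ((2 : ℝ) ^ m)⁻¹ ≤ C * harmonicScale.r m ^ ((n : NNReal) : ℝ) := by
  obtain ⟨B, hB⟩ := (tendsto_pow_const_div_const_pow_of_one_lt n
    (one_lt_two (α := ℝ))).bddAbove_range
  refine ⟨⟨2 * max B 0, by positivity⟩, fun m => ?_⟩
  have h1 : ((m + 1 : ℕ) : ℝ) ^ n / 2 ^ (m + 1) ≤ B := hB ⟨m + 1, rfl⟩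
  change _ ≤ 2 * max B 0 * (1 / ((m : ℝ) + 1)) ^ (((n : NNReal)) : ℝ)
  rw [NNReal.coe_natCast, Real.rpow_natCast, one_div, inv_pow, ← div_eq_mul_inv,
    le_div_iff₀ (by positivity)]
  have h2 := h1.trans (le_max_left B 0)
  rw [div_le_iff₀ (by positivity), pow_succ] at h2
  rw [inv_mul_le_iff₀ (by positivity)]
  push_cast at h2
  linarith

/-- For every `u` there is a zero-dimensional compact space that has Hausdorff dimension `u` at
each of its points, and whose product with the unit interval has Hausdorff dimension at most `u +
1`. -/
lemma exists_zeroDim_compactSpace (u : ℝ≥0∞) : ∃ (X : Type) (_ : MetricSpace X),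
    CompactSpace X ∧ Nonempty X ∧ HasSmallInductiveDimensionLT X 1 ∧
    (∀ W : Set X, IsOpen W → W.Nonempty → u ≤ dimH W) ∧
    dimH (univ : Set (X × unitInterval)) ≤ u + 1 := by
  induction u with
  | top =>
    refine ⟨CantorSpace harmonicScale, inferInstance, inferInstance, inferInstance,
      CantorSpace.zeroDim, fun W hW hne => ?_, by simp⟩
    refine top_le_iff.2 (ENNReal.eq_top_of_forall_nnreal_le fun x => ?_)
    obtain ⟨n, hn⟩ := exists_nat_ge x
    obtain ⟨C, hC⟩ := exists_le_mul_harmonicScale_rpow (n + 1)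
    refine le_trans ?_ (CantorSpace.le_dimH_of_isOpen (by positivity) hC hW hne)
    exact_mod_cast hn.trans (by simp)
  | coe u =>
    rcases eq_zero_or_pos u with rfl | hu
    · refine ⟨PUnit, inferInstance, inferInstance, inferInstance, ?_, fun W _ _ => by simp, ?_⟩
      · rw [hasSmallInductiveDimensionLT_one_iff_forall_isOpen]
        exact fun U hU x hx => ⟨U, isClopen_discrete U, hx, Subset.rfl⟩
      · have hiso : Isometry fun p : PUnit × unitInterval => p.2 := Isometry.of_dist_eq
          fun p q => by rw [Prod.dist_eq, Subsingleton.elim p.1 q.1, dist_self,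
            max_eq_right dist_nonneg]
        rw [← hiso.dimH_image, ENNReal.coe_zero, zero_add]
        exact (dimH_mono (subset_univ _)).trans dimH_unitInterval.le
    · refine ⟨CantorSpace (geometricScale u hu), inferInstance, inferInstance, inferInstance,
        CantorSpace.zeroDim, fun W hW hne => ?_, ?_⟩
      · exact CantorSpace.le_dimH_of_isOpen hu (C := 1)
          (fun m => by rw [geometricScale_rpow]; simp) hW hne
      · exact CantorSpace.dimH_prod_unitInterval_le (by simp [geometricScale])
          (geometricScale_rpow u hu)

end CantorSpace

/-! ### Realization of prescribed dimensions -/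

section Realization

lemma hausDim_le_max_of_union {X Y K : Type*} [MetricSpace X] [MetricSpace Y] [MetricSpace K]
    [Nonempty X] [Nonempty Y] {f : X → K} {g : Y → K} (hf : Isometry f) (hg : Isometry g)
    (hfg : range f ∪ range g = univ) : hausDim K ≤ max (hausDim X) (hausDim Y) := by
  have : Nonempty K := .map f ‹_›
  simp only [hausDim_eq_dimH]
  rw [← hfg, dimH_union, ← image_univ, ← image_univ, hf.dimH_image, hg.dimH_image,
    ← EReal.coe_ennreal_strictMono.monotone.map_max]

lemma hausDim_cube_le {n : ℕ} : hausDim (Fin n → unitInterval) ≤ n := by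
  have hiso : Isometry fun (x : Fin n → unitInterval) i => (x i : ℝ) :=
    Isometry.of_dist_eq fun x y => rfl
  rw [hausDim_eq_dimH, ← hiso.dimH_image, ← coe_ennreal_natCast,
    EReal.coe_ennreal_le_coe_ennreal_iff, ← Real.dimH_univ_pi_fin]
  exact dimH_mono (subset_univ _)

lemma le_topDim_cube {n : ℕ} : (n : EReal) ≤ topDim (Fin n → unitInterval) :=
  not_lt.1 fun h => not_hasSmallInductiveDimensionLT_cube n (topDim_lt_natCast_iff.1 h)

lemma topDim_eq_zero {X : Type*} [TopologicalSpace X] [Nonempty X]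
    (h : HasSmallInductiveDimensionLT X 1) : topDim X = 0 := by
  have h1 : topDim X ≤ (0 : ℕ) := topDim_le_natCast_iff.2 h
  rcases topDim_eq_top_or_natCast X with h2 | ⟨m, h2⟩
  · rw [h2] at h1
    exact absurd (top_le_iff.1 h1) (EReal.natCast_ne_top 0)
  · rw [h2, EReal.natCast_le_iff] at h1
    rw [h2, Nat.le_zero.1 h1, Nat.cast_zero]

lemma exists_compact_of_zeroDim {t : EReal} (ht : 0 ≤ t) :
    ∃ (K : Type) (_ : MetricSpace K), CompactSpace K ∧ Nonempty K ∧
      HasSmallInductiveDimensionLT K 1 ∧ hausDim K = t := by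
  obtain ⟨X, _, hc, hne, h0, h1, h2⟩ := exists_zeroDim_compactSpace t.toENNReal
  refine ⟨X, inferInstance, hc, hne, h0, ?_⟩
  rw [hausDim_eq_dimH, (dimH_le_of_dimH_prod_unitInterval_le h2).antisymm
    (h1 univ isOpen_univ univ_nonempty), EReal.coe_toENNReal ht]

/-- The product of a Cantor space and an interval, which is responsible for the topological
Hausdorff dimension. -/
lemma exists_compact_of_oneDim {s : EReal} (hs : 1 ≤ s) :
    ∃ (K : Type) (_ : MetricSpace K), CompactSpace K ∧ Nonempty K ∧
      HasSmallInductiveDimensionLT K 2 ∧ s ≤ topHausDim K ∧ hausDim K ≤ s := by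
  obtain ⟨X, _, hc, hne, h0, h1, h2⟩ := exists_zeroDim_compactSpace (s - 1).toENNReal
  have hs1 : ((s - 1).toENNReal : EReal) + 1 = s := by
    rw [EReal.coe_toENNReal (ereal_le_sub_one_iff.2 (by simpa using hs))]
    exact EReal.sub_add_cancel
  refine ⟨X × unitInterval, inferInstance, inferInstance, inferInstance,
    hasSmallInductiveDimensionLT_prod_unitInterval h0, ?_, ?_⟩
  · exact hs1 ▸ le_topHausDim_prod_unitInterval h1
  · rw [hausDim_eq_dimH, ← hs1]
    exact_mod_cast h2

lemma exists_compact_of_top : ∃ (K : Type) (_ : MetricSpace K), CompactSpace K ∧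
    topDim K = ⊤ ∧ topHausDim K = ⊤ ∧ hausDim K = ⊤ := by
  let := metrizableSpaceMetric (ℕ → unitInterval)
  have htop : topDim (ℕ → unitInterval) = ⊤ := by
    rcases topDim_eq_top_or_natCast (ℕ → unitInterval) with h | ⟨m, h⟩
    · exact h
    -- The Hilbert cube contains all finite-dimensional cubes.
    let e : (Fin (m + 1) → unitInterval) → ℕ → unitInterval := fun x k =>
      if h : k < m + 1 then x ⟨k, h⟩ else 0
    have he : Continuous e := continuous_pi fun k => by
      by_cases hk : k < m + 1
      · simp only [e, dif_pos hk]
        exact continuous_apply _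
      · simp only [e, dif_neg hk]
        exact continuous_const
    have hid : (fun (y : ℕ → unitInterval) (i : Fin (m + 1)) => y i) ∘ e = id := by
      funext x i
      exact dif_pos i.2
    have hind : IsInducing e := .of_comp he (by fun_prop) (hid ▸ IsInducing.id)
    have := (le_topDim_cube (n := m + 1)).trans hind.topDim_le
    rw [h, EReal.natCast_le_iff] at this
    omega
  have h1 : topHausDim (ℕ → unitInterval) = ⊤ :=
    top_le_iff.1 (htop ▸ topDim_le_topHausDim (ℕ → unitInterval))
  exact ⟨ℕ → unitInterval, inferInstance, inferInstance, htop, h1,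
    top_le_iff.1 (h1 ▸ topHausDim_le_hausDim (ℕ → unitInterval))⟩

/-- The disjoint union of a cube, a product of a Cantor space and an interval, and a Cantor space
realizes three prescribed dimensions. -/
lemma exists_compact_of_natCast {n : ℕ} (hn : 1 ≤ n) {s t : EReal} (hs : 1 ≤ s)
    (hns : (n : EReal) ≤ s) (hst : s ≤ t) : ∃ (K : Type) (_ : MetricSpace K), CompactSpace K ∧
      topDim K = n ∧ topHausDim K = s ∧ hausDim K = t := by
  obtain ⟨C, _, hCc, hCne, hC0, hCt⟩ :=
    exists_compact_of_zeroDim ((zero_le_one.trans hs).trans hst)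
  obtain ⟨M, _, hMc, hMne, hM1, hMs, hMs'⟩ := exists_compact_of_oneDim hs
  obtain ⟨L, _, i, j, hLc, hi, hj, hir, hjr, hij⟩ := exists_compact_union (X := M) (Y := C)
  obtain ⟨K, _, f, g, hKc, hf, hg, hfr, hgr, hfg⟩ :=
    exists_compact_union (X := Fin n → unitInterval) (Y := L)
  have hLne : Nonempty L := .map i hMne
  have hKne : Nonempty K := .map g hLne
  refine ⟨K, inferInstance, hKc, le_antisymm ?_ ?_, le_antisymm ?_ ?_, le_antisymm ?_ ?_⟩
  · rw [topDim_le_natCast_iff]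
    refine .union hf.isEmbedding hg.isEmbedding hfr hgr hfg ?_ (.union hi.isEmbedding hj.isEmbedding
      hir hjr hij (hM1.mono (by omega)) (hC0.mono (by omega)))
    refine hasSmallInductiveDimensionLT_of_hausDim_lt (hausDim_cube_le.trans_lt ?_)
    exact EReal.natCast_lt_iff.2 n.lt_succ_self
  · exact le_topDim_cube.trans hf.isEmbedding.isInducing.topDim_le
  · refine topHausDim_le (.union hf hg hfr hgr hfg ?_ (.union hi hj hir hjr hij ?_ ?_))
    · exact (hasThinBasis_hausDim_sub_one _).mono
        (EReal.sub_le_sub (hausDim_cube_le.trans hns) le_rfl)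
    · exact (hasThinBasis_hausDim_sub_one _).mono (EReal.sub_le_sub hMs' le_rfl)
    · refine (hasThinBasis_of_zeroDim hC0).mono (ereal_le_sub_one_iff.2 ?_)
      rw [ereal_neg_one_add_one]
      exact zero_le_one.trans hs
  · exact hMs.trans (hg.comp hi).topHausDim_le
  · refine (hausDim_le_max_of_union hf hg hfg).trans (max_le ?_
      ((hausDim_le_max_of_union hi hj hij).trans (max_le ?_ hCt.le)))
    · exact (hausDim_cube_le.trans hns).trans hst
    · exact hMs'.trans hst
  · exact hCt.ge.trans (hg.comp hj).hausDim_le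

/-- The conditions satisfied by the three dimensions of any metric space. -/
lemma dimensions_admissible (X : Type*) [MetricSpace X] :
    (topDim X = -1 ∧ topHausDim X = -1 ∧ hausDim X = -1) ∨
      (topDim X = 0 ∧ topHausDim X = 0 ∧ 0 ≤ hausDim X) ∨
      ((topDim X = ⊤ ∨ ∃ n : ℕ, 1 ≤ n ∧ topDim X = (n : EReal)) ∧ 1 ≤ topHausDim X ∧
        1 ≤ hausDim X ∧ topDim X ≤ topHausDim X ∧ topHausDim X ≤ hausDim X) := by
  rcases isEmpty_or_nonempty X with h | h
  · exact .inl ⟨topDim_of_isEmpty X, topHausDim_of_isEmpty X, hausDim_of_isEmpty X⟩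
  have h1 := topDim_le_topHausDim X
  have h2 := topHausDim_le_hausDim X
  rcases eq_or_ne (topDim X) 0 with h0 | h0
  · exact .inr (.inl ⟨h0, topHausDim_eq_zero_of_topDim_eq_zero h0,
      (topHausDim_nonneg X).trans h2⟩)
  have h3 : topDim X = ⊤ ∨ ∃ n : ℕ, 1 ≤ n ∧ topDim X = (n : EReal) := by
    refine (topDim_eq_top_or_natCast X).imp_right ?_
    rintro ⟨n, hn⟩
    refine ⟨n, Nat.one_le_iff_ne_zero.2 ?_, hn⟩
    rintro rfl
    exact h0 (by simpa using hn)
  have h4 : 1 ≤ topDim X := by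
    rcases h3 with h3 | ⟨n, hn, h3⟩
    · exact h3 ▸ le_top
    · rw [h3, ← Nat.cast_one]
      exact EReal.natCast_le_iff.2 hn
  exact .inr (.inr ⟨h3, h4.trans h1, (h4.trans h1).trans h2, h1, h2⟩)

lemma exists_compact_of_admissible {d s t : EReal}
    (h : (d = -1 ∧ s = -1 ∧ t = -1) ∨ (d = 0 ∧ s = 0 ∧ 0 ≤ t) ∨
      ((d = ⊤ ∨ ∃ n : ℕ, 1 ≤ n ∧ d = (n : EReal)) ∧ 1 ≤ s ∧ 1 ≤ t ∧ d ≤ s ∧ s ≤ t)) :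
    ∃ (K : Type u) (_ : MetricSpace K), CompactSpace K ∧
      topDim K = d ∧ topHausDim K = s ∧ hausDim K = t := by
  have key : ∃ (K : Type) (_ : MetricSpace K), CompactSpace K ∧
      topDim K = d ∧ topHausDim K = s ∧ hausDim K = t := by
    rcases h with ⟨rfl, rfl, rfl⟩ | ⟨rfl, rfl, ht⟩ | ⟨rfl | ⟨n, hn, rfl⟩, hs, -, hds, hst⟩
    · exact ⟨Empty, inferInstance, inferInstance, topDim_of_isEmpty _, topHausDim_of_isEmpty _,
        hausDim_of_isEmpty _⟩
    · obtain ⟨K, _, hc, hne, h0, hK⟩ := exists_compact_of_zeroDim ht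
      exact ⟨K, inferInstance, hc, topDim_eq_zero h0,
        topHausDim_eq_zero_of_topDim_eq_zero (topDim_eq_zero h0), hK⟩
    · obtain rfl := top_le_iff.1 hds
      obtain rfl := top_le_iff.1 hst
      exact exists_compact_of_top
    · exact exists_compact_of_natCast hn hs hds hst
  obtain ⟨K, _, hc, rfl, rfl, rfl⟩ := key
  have hup : Isometry (ULift.up.{u} : K → ULift.{u} K) := Isometry.of_dist_eq fun _ _ => rfl
  have hdown : Isometry (ULift.down.{u} : ULift.{u} K → K) := Isometry.of_dist_eq fun _ _ => rfl
  refine ⟨ULift.{u} K, inferInstance, Function.Surjective.compactSpace hup.continuous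
    ULift.up_surjective, ?_, ?_, ?_⟩
  · exact le_antisymm hdown.isEmbedding.isInducing.topDim_le hup.isEmbedding.isInducing.topDim_le
  · rcases isEmpty_or_nonempty K with h | h
    · rw [topHausDim_of_isEmpty, topHausDim_of_isEmpty]
    · exact le_antisymm hdown.topHausDim_le hup.topHausDim_le
  · exact le_antisymm hdown.hausDim_le hup.hausDim_le

end Realization

theorem mainTheorem8 :
    (∀ d s t : EReal, List.TFAE
      [∃ (K : Type u) (_ : MetricSpace K), CompactSpace K ∧
          topDim K = d ∧ topHausDim K = s ∧ hausDim K = t,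
        ∃ (X : Type u) (_ : MetricSpace X), SeparableSpace X ∧
          topDim X = d ∧ topHausDim X = s ∧ hausDim X = t,
        ∃ (X : Type u) (_ : MetricSpace X),
          topDim X = d ∧ topHausDim X = s ∧ hausDim X = t,
        (d = -1 ∧ s = -1 ∧ t = -1) ∨
          (d = 0 ∧ s = 0 ∧ 0 ≤ t) ∨
          ((d = ⊤ ∨ ∃ n : ℕ, 1 ≤ n ∧ d = (n : EReal)) ∧ 1 ≤ s ∧ 1 ≤ t ∧ d ≤ s ∧ s ≤ t)]) ∧
    ¬ ∃ f : EReal → EReal → EReal, ∀ (K : Type u) [MetricSpace K] [CompactSpace K],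
        topHausDim K = f (topDim K) (hausDim K) := by
  refine ⟨fun d s t => ?_, ?_⟩
  · tfae_have 1 → 2 := fun ⟨K, hK, hc, h⟩ => ⟨K, hK, inferInstance, h⟩
    tfae_have 2 → 3 := fun ⟨X, hX, _, h⟩ => ⟨X, hX, h⟩
    tfae_have 3 → 4 := by
      rintro ⟨X, _, rfl, rfl, rfl⟩
      exact dimensions_admissible X
    tfae_have 4 → 1 := exists_compact_of_admissible
    tfae_finish
  · rintro ⟨f, hf⟩
    have h12 : (1 : EReal) ≤ 2 := by exact_mod_cast EReal.natCast_le_iff.2 one_le_two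
    have h1 : (1 : EReal) = ⊤ ∨ ∃ n : ℕ, 1 ≤ n ∧ (1 : EReal) = n := .inr ⟨1, le_rfl, by simp⟩
    obtain ⟨K, _, _, hKd, hKs, hKt⟩ := exists_compact_of_admissible.{u} (d := 1) (s := 1) (t := 2)
      (.inr (.inr ⟨h1, le_rfl, h12, le_rfl, h12⟩))
    obtain ⟨L, _, _, hLd, hLs, hLt⟩ := exists_compact_of_admissible.{u} (d := 1) (s := 2) (t := 2)
      (.inr (.inr ⟨h1, h12, h12, h12, le_rfl⟩))
    have hK := hf K
    have hL := hf L
    rw [hKd, hKt, hKs] at hK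
    rw [hLd, hLt, hLs, ← hK] at hL
    exact absurd (EReal.natCast_eq_iff.1 (by exact_mod_cast hL : ((2 : ℕ) : EReal) = (1 : ℕ)))
      (by norm_num)
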